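/- Let $N_n\ge 2$ ($n\ge 1$) be integers and let $B_n, L_n\subset\mathbb Z$ be finite sets such that, for every $n$, $0\in B_n\subset\{0,1,\dots,N_n-1\}$, $0\in L_n$, and the elements of $L_n$ are pairwise incongruent modulo $N_n$. For a finite set $A\subset\mathbb R$ put $\delta_A=\frac1{\#A}\sum_{a\in A}\delta_a$, and let $$\mu=\mu(N_n,B_n)=\delta_{\frac1{N_1}B_1}*\delta_{\frac1{N_1N_2}B_2}*\delta_{\frac1{N_1N_2N_3}B_3}*\cdots$$ be the associated Cantor-Moran measure. Let $\mu_{>n}$ be the convolution of all these factors except the first $n$, and let $\nu_{>n}(E)=\mu_{>n}((N_1\cdots N_n)^{-1}E)$. Write $\widehat\nu(\xi)=\int e^{-2\pi i\xi x}\,d\nu(x)$. A family $\Phi$ of probability measures on $[0,1]$ is called equi-positive if there is $\epsilon_0>0$ such that for all $x\in[0,1]$ and $\nu\in\Phi$ there is $k\in\mathbb Z$ with $|\widehat\nu(x+k)|\ge\epsilon_0$. Suppose that there is a subsequence $n_1<n_2<\cdots$ such that $\{\nu_{>n_k}\}$ is equi-positive. (i) Suppose that $\{(N_n,B_n,L_n)\}$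 is a frame triple tower, that is, there are $0\le\epsilon_n<1$ with $\sum_n\epsilon_n<\infty$ such that for all $n$ and all $w\in\mathbb C^{B_n}$, $$(1-\epsilon_n)\|w\|\le\Big(\sum_{l\in L_n}\Big|\frac1{\sqrt{\#B_n}}\sum_{b\in B_n}w_b\,e^{-2\pi i bl/N_n}\Big|^2\Big)^{1/2}\le(1+\epsilon_n)\|w\|,$$ where $\|\cdot\|$ is the Euclidean norm. Then $\mu$ is frame-spectral with a frame spectrum in $\mathbb Z$: there are $\Lambda\subset\mathbb Z$ and $0<a\le b<\infty$ such that for all $f\in L^2(\mu)$, $$a\int|f|^2\,d\mu\le\sum_{\lambda\in\Lambda}\Big|\int f(x)e^{-2\pi i\lambda x}\,d\mu(x)\Big|^2\le b\int|f|^2\,d\mu.$$ (ii) Suppose that $\{(N_n,B_n,L_n)\}$ is a Hadamard triple tower, that is, for all $n$ one has $\#L_n=\#B_n\le N_n$ and the matrix $\frac1{\sqrt{\#B_n}}\big[e^{-2\pi i bl/N_n}\big]_{b\in B_n,\,l\in L_n}$ is unitary. Then $\mu$ is spectral with a spectrum in $\mathbb Z$: there is $\Lambda\subset\mathbb Z$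 such that $\{e^{2\pi i\lambda x}:\lambda\in\Lambda\}$ is an orthonormal basis of $L^2(\mu)$. -/

import Mathlib

open MeasureTheory
open scoped ENNReal Matrix

noncomputable section

namespace CantorMoran

/-- `δ_A = (1 / #A) ∑_{a ∈ A} δ_a`, the uniform probability measure on a finite set `A ⊂ ℝ`. -/
def uniformDirac (A : Finset ℝ) : Measure ℝ :=
  (A.card : ℝ≥0∞)⁻¹ • ∑ a ∈ A, Measure.dirac a

/-- The infinite convolution `m 0 * m 1 * m 2 * ⋯` of probability measures on `ℝ`: the law of
`∑ x_k`, where the `x_k` are independent and `x_k` has law `m k`. -/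
def infiniteConv (m : ℕ → Measure ℝ) : Measure ℝ :=
  (Measure.infinitePi m).map (fun x : ℕ → ℝ => ∑' k, x k)

/- All sequences are indexed from `0`: the terms `N 0, N 1, …` are `N_1, N_2, …`, and likewise
for `B` and `L`. -/

/-- The `k`-th factor `δ_{(N 0 ⋯ N k)⁻¹ B k}` of the Cantor-Moran measure. -/
def factor (N : ℕ → ℕ) (B : ℕ → Finset ℤ) (k : ℕ) : Measure ℝ :=
  uniformDirac ((B k).image fun b : ℤ => (b : ℝ) / ∏ i ∈ Finset.range (k + 1), (N i : ℝ))

/-- The Cantor-Moran measure `μ(N_n, B_n)`. -/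
def cantorMoran (N : ℕ → ℕ) (B : ℕ → Finset ℤ) : Measure ℝ :=
  infiniteConv (factor N B)

/-- The tail `μ_{>n}`: the convolution of all factors of `μ(N_n, B_n)` but the first `n`. -/
def tail (N : ℕ → ℕ) (B : ℕ → Finset ℤ) (n : ℕ) : Measure ℝ :=
  infiniteConv fun k => factor N B (n + k)

/-- The rescaled tail `ν_{>n}(E) = μ_{>n}((N_1 ⋯ N_n)⁻¹ E)`. -/
def nu (N : ℕ → ℕ) (B : ℕ → Finset ℤ) (n : ℕ) : Measure ℝ :=
  (tail N B n).map fun x => (∏ i ∈ Finset.range n, (N i : ℝ)) * x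

/-- The Fourier transform `∫ e^{-2πiξx} dν(x)` of a measure on `ℝ`. -/
def fourierTransform (ν : Measure ℝ) (ξ : ℝ) : ℂ :=
  ∫ x : ℝ, Complex.exp (-2 * Real.pi * Complex.I * ξ * x) ∂ν

/-- Equi-positive families of (probability) measures (on `[0, 1]`). -/
def EquiPositive (Φ : Set (Measure ℝ)) : Prop :=
  ∃ ε₀ : ℝ, 0 < ε₀ ∧ ∀ x ∈ Set.Icc (0 : ℝ) 1, ∀ ν ∈ Φ, ∃ k : ℤ,
    ε₀ ≤ ‖fourierTransform ν (x + k)‖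

/-- The matrix `H = #B^{-1/2} [e^{-2πi b l / N}]` with `b ∈ B`, `l ∈ L`. -/
def expMatrix (N : ℕ) (B L : Finset ℤ) : Matrix B L ℂ :=
  Matrix.of fun b l => ((Real.sqrt B.card)⁻¹ : ℂ) *
    Complex.exp (-2 * Real.pi * Complex.I * ((b : ℤ) : ℂ) * ((l : ℤ) : ℂ) / N)

/-- `(N, B, L)` is a Hadamard triple. -/
def IsHadamardTriple (N : ℕ) (B L : Finset ℤ) : Prop :=
  2 ≤ N ∧ L.card = B.card ∧ B.card ≤ N ∧ (expMatrix N B L)ᴴ * expMatrix N B L = 1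

/-- `(N, B, L)` is a frame triple with constants `c₁, c₂`:
`c₁ ‖w‖ ≤ ‖(#B^{-1/2} ∑_b e^{-2πi b l / N} w_b)_{l ∈ L}‖ ≤ c₂ ‖w‖` in the Euclidean norms,
for all `w ∈ ℂ^B`. -/
def IsFrameTriple (N : ℕ) (B L : Finset ℤ) (c₁ c₂ : ℝ) : Prop :=
  2 ≤ N ∧ 0 < c₁ ∧ c₁ ≤ c₂ ∧ ∀ w : EuclideanSpace ℂ B,
    c₁ * ‖w‖ ≤ ‖(WithLp.toLp 2 ((expMatrix N B L)ᵀ *ᵥ w.ofLp) : EuclideanSpace ℂ L)‖ ∧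
    ‖(WithLp.toLp 2 ((expMatrix N B L)ᵀ *ᵥ w.ofLp) : EuclideanSpace ℂ L)‖ ≤ c₂ * ‖w‖

/-- Frame triple towers. -/
def IsFrameTripleTower (N : ℕ → ℕ) (B L : ℕ → Finset ℤ) : Prop :=
  ∃ ε : ℕ → ℝ, (∀ n, 0 ≤ ε n ∧ ε n < 1) ∧ Summable ε ∧
    ∀ n, IsFrameTriple (N n) (B n) (L n) (1 - ε n) (1 + ε n)

/-- Hadamard triple towers. -/
def IsHadamardTripleTower (N : ℕ → ℕ) (B L : ℕ → Finset ℤ) : Prop :=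
  ∀ n, IsHadamardTriple (N n) (B n) (L n)

/-- `Λ` is a frame spectrum of the probability measure `μ`: the exponentials `e^{2πiλx}`,
`λ ∈ Λ`, form a Fourier frame for `μ`. -/
def IsFrameSpectrum (μ : Measure ℝ) (Λ : Set ℝ) : Prop :=
  IsProbabilityMeasure μ ∧ Λ.Countable ∧
    ∃ a b : ℝ, 0 < a ∧ a ≤ b ∧ ∀ f : ℝ → ℂ, MemLp f 2 μ →
      (Summable fun l : Λ =>
        ‖∫ x, f x * Complex.exp (-2 * Real.pi * Complex.I * (l : ℝ) * x) ∂μ‖ ^ 2) ∧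
      a * ∫ x, ‖f x‖ ^ 2 ∂μ ≤
        ∑' l : Λ, ‖∫ x, f x * Complex.exp (-2 * Real.pi * Complex.I * (l : ℝ) * x) ∂μ‖ ^ 2 ∧
      ∑' l : Λ, ‖∫ x, f x * Complex.exp (-2 * Real.pi * Complex.I * (l : ℝ) * x) ∂μ‖ ^ 2 ≤
        b * ∫ x, ‖f x‖ ^ 2 ∂μ

/-- `Λ` is a spectrum of the probability measure `μ`: it is countable, and the exponentials
`e^{2πiλx}`, `λ ∈ Λ`, form an orthonormal (Hilbert) basis of `L²(μ)`. -/
def IsSpectrum (μ : Measure ℝ) (Λ : Set ℝ) : Prop :=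
  IsProbabilityMeasure μ ∧ Λ.Countable ∧
    ∃ e : HilbertBasis Λ ℂ (Lp ℂ 2 μ), ∀ l : Λ,
      (e l : ℝ → ℂ) =ᵐ[μ] fun x => Complex.exp (2 * Real.pi * Complex.I * (l : ℝ) * x)

end CantorMoran

end

noncomputable section

namespace CantorMoran

open ProbabilityTheory Filter Topology

/-! Realise `μ` as the law of a random series whose independent digits have the laws of the factors
(`digitLaw`). Its first `n` digits sum to a uniform point of `digitSet N B n` divided by `scale N
n`, and the remainder is independent of them, with Fourier transform given by `nu N B n`.

At a finite level everything is algebra. Frame triples multiply in mixed radix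
(`IsFrameLevel.comp`), their constants multiply too, and the frequencies matter only modulo the
scale (`IsFrameLevel.shift`). That last freedom is where equi-positivity enters. In `exists_next` a
finite set of frequencies is extended to a much higher level of the given subsequence. The old
frequencies are tiny compared with the new scale, so the tail transform is near `1` there and they
can be kept. Each new one is moved by a multiple of the scale to a point where the tail transform is
at least `ε₀`. The result is an increasing sequence of finite sets `Λ k` with a uniform lower bound
`δ` for the tail transforms.

The union of the `Λ k` is the spectrum. The upper bound passes to the limit in its dual form
(`integral_trigPoly_le`), where it concerns a fixed trigonometric polynomial. For the lower bound
(`lower_of_continuous`, `lower`), a coefficient of a function of the head sum is a finite-level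
coefficient times the tail transform, so only the factor `δ ^ 2` is lost. The error of replacing the
full sum by the head sum is controlled by the Bessel inequality already proved.

The lower constant is not sharp, but the upper constant is preserved exactly. For Hadamard triples
it equals `1`, which forces unit vectors to be orthogonal, and any positive lower bound then gives
completeness (`HasFrameBounds.isSpectrum`). -/

/-- The character `e^{-2πit}`. -/
def ch (t : ℝ) : ℂ := Complex.exp (-2 * Real.pi * Complex.I * t)

lemma ch_add (s t : ℝ) : ch (s + t) = ch s * ch t := by
  simp only [ch, ← Complex.exp_add]
  congr 1
  push_cast
  ring

lemma ch_int (n : ℤ) : ch n = 1 := by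
  rw [ch, Complex.exp_eq_one_iff]
  exact ⟨-n, by push_cast; ring⟩

lemma ch_add_int (t : ℝ) (n : ℤ) : ch (t + n) = ch t := by rw [ch_add, ch_int, mul_one]

lemma ch_neg (t : ℝ) : ch (-t) = starRingEnd ℂ (ch t) := by
  rw [ch, ch, ← Complex.exp_conj]
  congr 1
  simp [Complex.conj_ofNat]

lemma norm_ch (t : ℝ) : ‖ch t‖ = 1 := by
  rw [ch, Complex.norm_exp]
  simp

lemma continuous_ch : Continuous ch := by
  unfold ch
  fun_prop

lemma norm_ch_sub_one_le (t : ℝ) : ‖ch t - 1‖ ≤ 2 * Real.pi * |t| := by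
  have h := Real.norm_exp_I_mul_ofReal_sub_one_le (x := -2 * Real.pi * t)
  have e : Complex.exp (Complex.I * ((-2 * Real.pi * t : ℝ) : ℂ)) = ch t := by
    rw [ch]
    congr 1
    push_cast
    ring
  rw [e] at h
  refine h.trans (le_of_eq ?_)
  rw [Real.norm_eq_abs, abs_mul, abs_mul, abs_neg, abs_two, abs_of_pos Real.pi_pos]

/-! ### Finite frame levels: composition, change of frequencies, duality -/

/-- `(M, A, Λ)` is a frame triple with bounds `c`, `C` (of the squared norms), and the elements of
`Λ` are pairwise incongruent modulo `M`. -/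
structure IsFrameLevel (M : ℕ) (A Λ : Finset ℤ) (c C : ℝ) : Prop where
  incongr : ∀ l ∈ Λ, ∀ l' ∈ Λ, l ≡ l' [ZMOD M] → l = l'
  lower : ∀ w : ℤ → ℂ, c * (A.card * ∑ a ∈ A, ‖w a‖ ^ 2) ≤
    ∑ l ∈ Λ, ‖∑ a ∈ A, w a * ch (a * l / M)‖ ^ 2
  upper : ∀ w : ℤ → ℂ, ∑ l ∈ Λ, ‖∑ a ∈ A, w a * ch (a * l / M)‖ ^ 2 ≤
    C * (A.card * ∑ a ∈ A, ‖w a‖ ^ 2)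

/-- Squaring the norm inequalities and clearing the factor `1 / #B` gives the unnormalised form, in
which constants multiply under composition. -/
lemma IsFrameTriple.isFrameLevel {N : ℕ} {B L : Finset ℤ} {c C : ℝ} (h : IsFrameTriple N B L c C)
    (hB : B.Nonempty) (hL : ∀ l ∈ L, ∀ l' ∈ L, l ≡ l' [ZMOD N] → l = l') :
    IsFrameLevel N B L (c ^ 2) (C ^ 2) := by
  obtain ⟨-, hc, hcC, h⟩ := h
  have hB' : (0 : ℝ) < B.card := by exact_mod_cast hB.card_pos
  have key : ∀ w : ℤ → ℂ,
      c ^ 2 * (B.card * ∑ a ∈ B, ‖w a‖ ^ 2) ≤ ∑ l ∈ L, ‖∑ a ∈ B, w a * ch (a * l / N)‖ ^ 2 ∧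
      ∑ l ∈ L, ‖∑ a ∈ B, w a * ch (a * l / N)‖ ^ 2 ≤ C ^ 2 * (B.card * ∑ a ∈ B, ‖w a‖ ^ 2) := by
    intro w
    set v : EuclideanSpace ℂ B := WithLp.toLp 2 fun b => w b with hv
    have h1 : ‖v‖ ^ 2 = ∑ a ∈ B, ‖w a‖ ^ 2 := by
      rw [EuclideanSpace.norm_sq_eq, hv, ← Finset.sum_coe_sort B]
    have h2 : ‖(WithLp.toLp 2 ((expMatrix N B L)ᵀ *ᵥ v.ofLp) : EuclideanSpace ℂ L)‖ ^ 2 =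
        (B.card : ℝ)⁻¹ * ∑ l ∈ L, ‖∑ a ∈ B, w a * ch (a * l / N)‖ ^ 2 := by
      rw [EuclideanSpace.norm_sq_eq, Finset.mul_sum, ← Finset.sum_coe_sort L]
      refine Finset.sum_congr rfl fun l _ => ?_
      have : ((expMatrix N B L)ᵀ *ᵥ v.ofLp) l =
          ((Real.sqrt B.card)⁻¹ : ℂ) * ∑ a ∈ B, w a * ch (a * l / N) := by
        rw [Finset.mul_sum, ← Finset.sum_coe_sort B]
        refine Finset.sum_congr rfl fun b _ => ?_
        simp only [expMatrix, Matrix.transpose_apply, Matrix.of_apply, hv, ch]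
        push_cast
        rw [show (-2 * Real.pi * Complex.I * ((b : ℤ) : ℂ) * ((l : ℤ) : ℂ) / N : ℂ) =
          -2 * Real.pi * Complex.I * (((b : ℤ) : ℂ) * ((l : ℤ) : ℂ) / N) by ring]
        ring
      simp only [this, norm_mul, mul_pow]
      congr 1
      rw [norm_inv, Complex.norm_real, Real.norm_of_nonneg (Real.sqrt_nonneg _), inv_pow,
        Real.sq_sqrt hB'.le]
    obtain ⟨ha, hb⟩ := h v
    have ha' := pow_le_pow_left₀ (by positivity) ha 2
    have hb' := pow_le_pow_left₀ (by positivity) hb 2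
    rw [mul_pow, h1, h2] at ha' hb'
    constructor
    · rw [inv_mul_eq_div, le_div_iff₀ hB'] at ha'
      linarith
    · rw [inv_mul_eq_div, div_le_iff₀ hB'] at hb'
      linarith
  exact ⟨hL, fun w => (key w).1, fun w => (key w).2⟩

/-- A Hadamard triple is a frame triple with both constants equal to `1`. -/
lemma IsHadamardTriple.isFrameTriple {N : ℕ} {B L : Finset ℤ} (h : IsHadamardTriple N B L) :
    IsFrameTriple N B L 1 1 := by
  obtain ⟨hN, hc, -, hE⟩ := h
  refine ⟨hN, one_pos, le_rfl, fun w => ?_⟩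
  have hE' : expMatrix N B L * (expMatrix N B L)ᴴ = 1 :=
    (Matrix.mul_eq_one_comm_of_card_eq L B ℂ (by simpa using hc)).1 hE
  suffices H : ‖(WithLp.toLp 2 ((expMatrix N B L)ᵀ *ᵥ w.ofLp) : EuclideanSpace ℂ L)‖ = ‖w‖ by
    rw [H, one_mul]
    exact ⟨le_rfl, le_rfl⟩
  set E := expMatrix N B L
  -- The frame inequality concerns `Eᵀ`, so it is the other unitarity relation `E * Eᴴ = 1` that
  -- makes it an isometry; this uses `#L = #B`.
  have hT : (Eᵀ)ᴴ * Eᵀ = 1 := by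
    rw [show (Eᵀ)ᴴ = (Eᴴ)ᵀ from rfl, ← Matrix.transpose_mul, hE', Matrix.transpose_one]
  have hsq : ∀ {ι : Type} [Fintype ι] (u : ι → ℂ),
      ((‖(WithLp.toLp 2 u : EuclideanSpace ℂ ι)‖ ^ 2 : ℝ) : ℂ) = star u ⬝ᵥ u := by
    intro ι _ u
    rw [EuclideanSpace.norm_sq_eq]
    simp only [dotProduct, Pi.star_apply, RCLike.star_def, Complex.conj_mul']
    push_cast
    rfl
  have h2 : ((‖(WithLp.toLp 2 (Eᵀ *ᵥ w.ofLp) : EuclideanSpace ℂ L)‖ ^ 2 : ℝ) : ℂ) =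
      ((‖w‖ ^ 2 : ℝ) : ℂ) := by
    rw [hsq, show ‖w‖ = ‖(WithLp.toLp 2 w.ofLp : EuclideanSpace ℂ B)‖ from rfl, hsq,
      Matrix.star_mulVec, Matrix.dotProduct_mulVec, Matrix.vecMul_vecMul, hT, Matrix.vecMul_one]
  have h3 := Complex.ofReal_injective h2
  exact (pow_left_inj₀ (norm_nonneg _) (norm_nonneg _) two_ne_zero).1 h3

/-- Mixed radix digit sets: `N * A + B`. -/
def radixSum (N : ℤ) (A B : Finset ℤ) : Finset ℤ :=
  (A ×ˢ B).image fun p => N * p.1 + p.2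

/-- Reduction modulo `N` recovers the low digit, and cancelling `N` then recovers the high part.
Used both for digits and, with the roles of the two factors exchanged, for frequencies. -/
lemma radix_injective {N : ℕ} {B : Finset ℤ} (hB : ∀ b ∈ B, ∀ b' ∈ B, b ≡ b' [ZMOD N] → b = b')
    (hN : 0 < N) (A : Finset ℤ) :
    Set.InjOn (fun p : ℤ × ℤ => (N : ℤ) * p.1 + p.2) (A ×ˢ B : Finset (ℤ × ℤ)) := by
  rintro ⟨a, b⟩ h ⟨a', b'⟩ h' e
  simp only [Finset.coe_product, Set.mem_prod, Finset.mem_coe] at h h' e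
  have hb : b = b' := by
    refine hB b h.2 b' h'.2 ?_
    have := congrArg (· % (N : ℤ)) e
    simpa [Int.ModEq, Int.add_emod] using this
  subst hb
  have : (N : ℤ) * a = N * a' := by linarith
  have := mul_left_cancel₀ (by exact_mod_cast hN.ne') this
  rw [this]

lemma incongr_of_subset_Ico {N : ℕ} {B : Finset ℤ} (hB : B ⊆ Finset.Ico (0 : ℤ) N) :
    ∀ b ∈ B, ∀ b' ∈ B, b ≡ b' [ZMOD N] → b = b' := by
  intro b hb b' hb' e
  have h := Finset.mem_Ico.1 (hB hb)
  have h' := Finset.mem_Ico.1 (hB hb')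
  rwa [Int.ModEq, Int.emod_eq_of_lt h.1 h.2, Int.emod_eq_of_lt h'.1 h'.2] at e

lemma sum_radixSum {N : ℕ} {B : Finset ℤ} (hB : ∀ b ∈ B, ∀ b' ∈ B, b ≡ b' [ZMOD N] → b = b')
    (hN : 0 < N) (A : Finset ℤ) {E : Type*} [AddCommMonoid E] (f : ℤ → E) :
    ∑ x ∈ radixSum N A B, f x = ∑ a ∈ A, ∑ b ∈ B, f (N * a + b) := by
  rw [radixSum, Finset.sum_image (radix_injective hB hN A), Finset.sum_product]

lemma card_radixSum {N : ℕ} {B : Finset ℤ} (hB : ∀ b ∈ B, ∀ b' ∈ B, b ≡ b' [ZMOD N] → b = b')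
    (hN : 0 < N) (A : Finset ℤ) : (radixSum N A B).card = A.card * B.card := by
  rw [radixSum, Finset.card_image_of_injOn (radix_injective hB hN A), Finset.card_product]

/-- Composition of frame levels. -/
lemma IsFrameLevel.comp {M N : ℕ} {A B Λ L : Finset ℤ} {c C c' C' : ℝ}
    (h : IsFrameLevel M A Λ c C) (h' : IsFrameLevel N B L c' C')
    (hB : ∀ b ∈ B, ∀ b' ∈ B, b ≡ b' [ZMOD N] → b = b') (hM : 0 < M) (hN : 0 < N)
    (hc' : 0 ≤ c') (hC' : 0 ≤ C') :
    IsFrameLevel (M * N) (radixSum N A B) (radixSum M L Λ) (c * c') (C * C') := by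
  have hM' : (M : ℝ) ≠ 0 := by exact_mod_cast hM.ne'
  have hN' : (N : ℝ) ≠ 0 := by exact_mod_cast hN.ne'
  have hsum : ∀ w : ℤ → ℂ, ∀ l ∈ Λ, ∀ l' : ℤ,
      ∑ x ∈ radixSum N A B, w x * ch (x * ((M * l' + l : ℤ) : ℝ) / ((M * N : ℕ) : ℝ)) =
      ∑ b ∈ B, ((∑ a ∈ A, w (N * a + b) * ch (a * l / M)) * ch (b * l / (M * N))) *
        ch (b * l' / N) := by
    intro w l _ l'
    rw [sum_radixSum hB hN, Finset.sum_comm]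
    refine Finset.sum_congr rfl fun b _ => ?_
    rw [Finset.sum_mul, Finset.sum_mul]
    refine Finset.sum_congr rfl fun a _ => ?_
    -- The cross term `a * l'` is an integer and drops out. What remains is the transform at level
    -- `M`, a unimodular twist depending on `b` and `l`, and the transform at level `N`.
    have e : (((N * a + b : ℤ) : ℝ) * ((M * l' + l : ℤ) : ℝ) / ((M * N : ℕ) : ℝ)) =
        (a * l / M + b * l / (M * N) + b * l' / N) + ((a * l' : ℤ) : ℝ) := by
      push_cast
      field_simp
      ring
    rw [e, ch_add_int, ch_add, ch_add]
    ring
  have hsq : ∀ w : ℤ → ℂ, ∑ l ∈ Λ, ∑ b ∈ B,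
      ‖(∑ a ∈ A, w (N * a + b) * ch (a * l / M)) * ch (b * l / (M * N))‖ ^ 2 =
      ∑ b ∈ B, ∑ l ∈ Λ, ‖∑ a ∈ A, w (N * a + b) * ch (a * l / M)‖ ^ 2 := by
    intro w
    rw [Finset.sum_comm]
    simp only [norm_mul, norm_ch, mul_one]
  have hsumA : ∀ w : ℤ → ℂ, ∑ x ∈ radixSum N A B, ‖w x‖ ^ 2 =
      ∑ b ∈ B, ∑ a ∈ A, ‖w (N * a + b)‖ ^ 2 := by
    intro w
    rw [sum_radixSum hB hN, Finset.sum_comm]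
  have hsumΛ : ∀ f : ℤ → ℝ, ∑ x ∈ radixSum M L Λ, f x = ∑ l ∈ Λ, ∑ l' ∈ L, f (M * l' + l) := by
    intro f
    rw [sum_radixSum h.incongr hM, Finset.sum_comm]
  refine ⟨?_, fun w => ?_, fun w => ?_⟩
  · intro x hx x' hx' e
    simp only [radixSum, Finset.mem_image, Finset.mem_product, Prod.exists] at hx hx'
    obtain ⟨l₁, l, ⟨hl₁, hl⟩, rfl⟩ := hx
    obtain ⟨l₁', l', ⟨hl₁', hl'⟩, rfl⟩ := hx'
    have e1 : l = l' := by
      refine h.incongr l hl l' hl' ?_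
      rw [Nat.cast_mul] at e
      have := Int.ModEq.of_mul_right (N : ℤ) e
      simpa [Int.ModEq, Int.add_emod] using this
    subst e1
    have e2 : l₁ = l₁' := by
      refine h'.incongr l₁ hl₁ l₁' hl₁' ?_
      rw [Nat.cast_mul] at e
      have := Int.ModEq.add_right_cancel' l e
      exact Int.ModEq.mul_left_cancel' (by exact_mod_cast hM.ne') this
    rw [e2]
  · rw [hsumA, card_radixSum hB hN, hsumΛ]
    calc c * c' * (((A.card * B.card : ℕ) : ℝ) * ∑ b ∈ B, ∑ a ∈ A, ‖w (N * a + b)‖ ^ 2)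
        = c' * (B.card * ∑ b ∈ B, c * (A.card * ∑ a ∈ A, ‖w (N * a + b)‖ ^ 2)) := by
          rw [← Finset.mul_sum, ← Finset.mul_sum]
          push_cast
          ring
      _ ≤ c' * (B.card * ∑ b ∈ B, ∑ l ∈ Λ, ‖∑ a ∈ A, w (N * a + b) * ch (a * l / M)‖ ^ 2) := by
          gcongr with b hb
          exact h.lower fun a => w (N * a + b)
      _ = ∑ l ∈ Λ, c' * (B.card * ∑ b ∈ B,
            ‖(∑ a ∈ A, w (N * a + b) * ch (a * l / M)) * ch (b * l / (M * N))‖ ^ 2) := by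
          rw [← hsq, Finset.mul_sum, Finset.mul_sum]
      _ ≤ _ := by
          refine Finset.sum_le_sum fun l hl => ?_
          simp only [hsum w l hl]
          exact h'.lower fun b => (∑ a ∈ A, w (N * a + b) * ch (a * l / M)) * ch (b * l / (M * N))
  · rw [hsumA, card_radixSum hB hN, hsumΛ]
    calc _ ≤ ∑ l ∈ Λ, C' * (B.card * ∑ b ∈ B,
            ‖(∑ a ∈ A, w (N * a + b) * ch (a * l / M)) * ch (b * l / (M * N))‖ ^ 2) := by
          refine Finset.sum_le_sum fun l hl => ?_
          simp only [hsum w l hl]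
          exact h'.upper fun b => (∑ a ∈ A, w (N * a + b) * ch (a * l / M)) * ch (b * l / (M * N))
      _ = C' * (B.card * ∑ b ∈ B, ∑ l ∈ Λ, ‖∑ a ∈ A, w (N * a + b) * ch (a * l / M)‖ ^ 2) := by
          rw [← hsq, Finset.mul_sum, Finset.mul_sum]
      _ ≤ C' * (B.card * ∑ b ∈ B, C * (A.card * ∑ a ∈ A, ‖w (N * a + b)‖ ^ 2)) := by
          gcongr with b hb
          exact h.upper fun a => w (N * a + b)
      _ = _ := by
          rw [← Finset.mul_sum, ← Finset.mul_sum]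
          push_cast
          ring

/-- The frequencies of a frame level may be changed modulo `M`. -/
lemma IsFrameLevel.shift {M : ℕ} {A Λ : Finset ℤ} {c C : ℝ} (h : IsFrameLevel M A Λ c C)
    (hM : 0 < M) (j : ℤ → ℤ) : IsFrameLevel M A (Λ.image fun l => l + M * j l) c C := by
  have hM' : (M : ℝ) ≠ 0 := by exact_mod_cast hM.ne'
  have hmod : ∀ l : ℤ, l + M * j l ≡ l [ZMOD M] := fun l => by simp [Int.ModEq]
  have hinj : Set.InjOn (fun l => l + M * j l) (Λ : Set ℤ) := by
    intro l hl l' hl' e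
    exact h.incongr l hl l' hl' ((hmod l).symm.trans ((show l + M * j l ≡ l' + M * j l' [ZMOD M] from congrArg (· % (M : ℤ)) e).trans (hmod l')))
  have hsum : ∀ w : ℤ → ℂ, ∑ x ∈ Λ.image fun l => l + M * j l,
      ‖∑ a ∈ A, w a * ch (a * x / M)‖ ^ 2 = ∑ l ∈ Λ, ‖∑ a ∈ A, w a * ch (a * l / M)‖ ^ 2 := by
    intro w
    rw [Finset.sum_image hinj]
    refine Finset.sum_congr rfl fun l _ => ?_
    congr 2
    refine Finset.sum_congr rfl fun a _ => ?_
    rw [← ch_add_int (a * l / M) (a * j l)]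
    congr 2
    push_cast
    field_simp
  refine ⟨?_, fun w => ?_, fun w => ?_⟩
  · intro x hx x' hx' e
    simp only [Finset.mem_image] at hx hx'
    obtain ⟨l, hl, rfl⟩ := hx
    obtain ⟨l', hl', rfl⟩ := hx'
    rw [h.incongr l hl l' hl' (((hmod l).symm.trans e).trans (hmod l'))]
  · rw [hsum]
    exact h.lower w
  · rw [hsum]
    exact h.upper w

/-- A real number `S` with `S² ≤ D * (C * S)` satisfies `S ≤ C * D`. -/
lemma le_mul_of_sq_le {S C D : ℝ} (hC : 0 ≤ C) (hD : 0 ≤ D) (h : S ^ 2 ≤ D * (C * S)) :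
    S ≤ C * D := by
  by_contra! hlt
  have : 0 ≤ C * D := by positivity
  nlinarith

/-- The Cauchy-Schwarz inequality for finite complex sums. -/
lemma norm_sum_mul_sq_le {ι : Type*} (s : Finset ι) (f g : ι → ℂ) :
    ‖∑ i ∈ s, f i * g i‖ ^ 2 ≤ (∑ i ∈ s, ‖f i‖ ^ 2) * ∑ i ∈ s, ‖g i‖ ^ 2 := by
  refine le_trans ?_ (Finset.sum_mul_sq_le_sq_mul_sq s (fun i => ‖f i‖) fun i => ‖g i‖)
  gcongr
  exact (norm_sum_le _ _).trans_eq (by simp)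

/-- The upper frame bound, in its dual form. -/
lemma IsFrameLevel.dual {M : ℕ} {A Λ F : Finset ℤ} {c C : ℝ} (h : IsFrameLevel M A Λ c C)
    (hC : 0 ≤ C) (hF : F ⊆ Λ) (z : ℤ → ℂ) :
    ∑ a ∈ A, ‖∑ l ∈ F, z l * ch (a * l / M)‖ ^ 2 ≤ C * A.card * ∑ l ∈ F, ‖z l‖ ^ 2 := by
  set g : ℤ → ℂ := fun a => ∑ l ∈ F, z l * ch (a * l / M) with hg
  set S := ∑ a ∈ A, ‖g a‖ ^ 2 with hS
  have hS0 : 0 ≤ S := by positivity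
  refine le_mul_of_sq_le (by positivity) (by positivity) ?_
  -- Duality: `S` is the pairing of `z` with the transform of the conjugate of `g`. Cauchy-Schwarz
  -- and the upper bound then give `S ^ 2` at most a constant times `S`.
  have h1 : (S : ℂ) = ∑ l ∈ F, z l * ∑ a ∈ A, starRingEnd ℂ (g a) * ch (a * l / M) := by
    simp only [Finset.mul_sum]
    rw [Finset.sum_comm, hS]
    push_cast
    refine Finset.sum_congr rfl fun a _ => ?_
    rw [← Complex.conj_mul']
    conv_lhs => rw [show g a = ∑ l ∈ F, z l * ch (a * l / M) from rfl]
    rw [Finset.mul_sum]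
    exact Finset.sum_congr rfl fun l _ => by ring
  have h2 : S ^ 2 = ‖(S : ℂ)‖ ^ 2 := by rw [Complex.norm_real, Real.norm_of_nonneg hS0]
  rw [h2, h1]
  refine (norm_sum_mul_sq_le _ _ _).trans ?_
  gcongr
  refine (Finset.sum_le_sum_of_subset_of_nonneg hF fun _ _ _ => by positivity).trans ?_
  refine (h.upper fun a => starRingEnd ℂ (g a)).trans (le_of_eq ?_)
  simp only [RCLike.norm_conj]
  ring

/-! ### The random digits, head sums and tail sums -/

/-- The scale `N_0 ⋯ N_{n-1}`. -/
def scale (N : ℕ → ℕ) (n : ℕ) : ℕ := ∏ i ∈ Finset.range n, N i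

/-- The integers with digits in `B 0, …, B (n-1)` in the mixed radix system `N 0, …, N (n-1)`. -/
def digitSet (N : ℕ → ℕ) (B : ℕ → Finset ℤ) : ℕ → Finset ℤ
  | 0 => {0}
  | n + 1 => radixSum (N n) (digitSet N B n) (B n)

/-- Standing assumptions on the moduli and the digit sets of a Cantor-Moran measure. -/
structure IsAdmissible (N : ℕ → ℕ) (B : ℕ → Finset ℤ) : Prop where
  two_le : ∀ n, 2 ≤ N n
  subset : ∀ n, B n ⊆ Finset.Ico (0 : ℤ) (N n)
  zero_mem : ∀ n, (0 : ℤ) ∈ B n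

lemma scale_succ (N : ℕ → ℕ) (n : ℕ) : scale N (n + 1) = scale N n * N n :=
  Finset.prod_range_succ _ _

lemma cast_scale (N : ℕ → ℕ) (n : ℕ) : (scale N n : ℝ) = ∏ i ∈ Finset.range n, (N i : ℝ) := by
  simp [scale]

/-- The law of the digits of the points of the Cantor-Moran measure. -/
def digitLaw (N : ℕ → ℕ) (B : ℕ → Finset ℤ) : Measure (ℕ → ℝ) := Measure.infinitePi (factor N B)

/-- The sum of the first `n` digits. -/
def headSum (n : ℕ) (x : ℕ → ℝ) : ℝ := ∑ k ∈ Finset.range n, x k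

/-- The sum of all digits but the first `n`. -/
def tailSum (n : ℕ) (x : ℕ → ℝ) : ℝ := ∑' k, x (n + k)

lemma measurable_headSum (n : ℕ) : Measurable (headSum n) := by
  unfold headSum
  fun_prop

lemma integral_uniformDirac (A : Finset ℝ) (g : ℝ → ℂ) :
    ∫ x, g x ∂uniformDirac A = (A.card : ℂ)⁻¹ * ∑ a ∈ A, g a := by
  rw [uniformDirac, integral_smul_measure, integral_finsetSum_measure]
  · simp [Complex.real_smul]
  · exact fun a _ => integrable_dirac (by simp)

lemma isProbabilityMeasure_uniformDirac {A : Finset ℝ} (hA : A.Nonempty) :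
    IsProbabilityMeasure (uniformDirac A) := by
  constructor
  rw [uniformDirac, Measure.smul_apply, Measure.finsetSum_apply]
  simp only [measure_univ, Finset.sum_const, nsmul_eq_mul, mul_one, smul_eq_mul]
  exact ENNReal.inv_mul_cancel (by simpa using hA.ne_empty) (by simp)

lemma ae_uniformDirac {A : Finset ℝ} {p : ℝ → Prop} (h : ∀ a ∈ A, p a) :
    ∀ᵐ x ∂uniformDirac A, p x := by
  refine Measure.ae_smul_measure ?_ _
  rw [← Measure.sum_coe_finset, Measure.ae_sum_iff]
  rintro ⟨a, ha⟩
  rw [ae_dirac_eq]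
  exact h a ha

/-- Almost sure bounds on the terms make a random series summable. -/
lemma ae_mem_Icc_infinitePi {m : ℕ → Measure ℝ} [∀ k, IsProbabilityMeasure (m k)] {u : ℕ → ℝ}
    (h : ∀ k, ∀ᵐ x ∂m k, x ∈ Set.Icc 0 (u k)) :
    ∀ᵐ x ∂Measure.infinitePi m, ∀ k, x k ∈ Set.Icc 0 (u k) := by
  rw [ae_all_iff]
  intro k
  have h1 := h k
  rw [← Measure.infinitePi_map_eval m k] at h1
  exact ae_of_ae_map (measurable_pi_apply k).aemeasurable h1

lemma aemeasurable_tsum_of_ae_summable {m : Measure (ℕ → ℝ)} (h : ∀ᵐ x ∂m, Summable x) :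
    AEMeasurable (fun x : ℕ → ℝ => ∑' k, x k) m := by
  refine aemeasurable_of_tendsto_metrizable_ae atTop
    (fun n => (measurable_headSum n).aemeasurable) ?_
  filter_upwards [h] with x hx
  exact hx.hasSum.tendsto_sum_nat

/-- Since `b ≤ N k - 1`, the `k`-th digit is at most `(N k - 1) / scale N (k + 1)`, which is exactly
a difference of consecutive inverse scales. Telescoping puts the tail sum in `[0, 1 / scale N n]`.
-/
lemma sum_gap (N : ℕ → ℕ) (n m : ℕ) : ∑ k ∈ Finset.range m,
    ((scale N (n + k) : ℝ)⁻¹ - (scale N (n + k + 1) : ℝ)⁻¹) =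
    (scale N n : ℝ)⁻¹ - (scale N (n + m) : ℝ)⁻¹ := by
  simpa [add_assoc] using Finset.sum_range_sub' (fun k => (scale N (n + k) : ℝ)⁻¹) m

lemma summable_of_mem_Icc {N : ℕ → ℕ} {n : ℕ} {x : ℕ → ℝ}
    (hx : ∀ k, x k ∈ Set.Icc 0 ((scale N (n + k) : ℝ)⁻¹ - (scale N (n + k + 1) : ℝ)⁻¹)) :
    Summable x ∧ ∑' k, x k ∈ Set.Icc 0 (scale N n : ℝ)⁻¹ := by
  have hb : ∀ m, ∑ k ∈ Finset.range m, x k ≤ (scale N n : ℝ)⁻¹ := fun m =>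
    (Finset.sum_le_sum fun k _ => (hx k).2).trans
      ((sum_gap N n m).trans_le (sub_le_self _ (by positivity)))
  exact ⟨summable_of_sum_range_le (fun k => (hx k).1) hb, tsum_nonneg fun k => (hx k).1,
    Real.tsum_le_of_sum_range_le (fun k => (hx k).1) hb⟩

namespace IsAdmissible

variable {N : ℕ → ℕ} {B : ℕ → Finset ℤ} (h : IsAdmissible N B)
include h

lemma pos (n : ℕ) : 0 < N n := two_pos.trans_le (h.two_le n)

lemma scale_pos (n : ℕ) : 0 < scale N n := Finset.prod_pos fun i _ => h.pos i

lemma two_pow_le_scale (n : ℕ) : 2 ^ n ≤ scale N n := by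
  simpa [scale] using Finset.prod_le_prod' (s := Finset.range n) fun i _ => h.two_le i

lemma isProbabilityMeasure_factor (k : ℕ) : IsProbabilityMeasure (factor N B k) :=
  isProbabilityMeasure_uniformDirac (Finset.Nonempty.image ⟨0, h.zero_mem k⟩ _)

lemma isProbabilityMeasure_digitLaw : IsProbabilityMeasure (digitLaw N B) := by
  have := h.isProbabilityMeasure_factor
  unfold digitLaw
  infer_instance

lemma integral_factor (k : ℕ) (g : ℝ → ℂ) :
    ∫ x, g x ∂factor N B k = ((B k).card : ℂ)⁻¹ * ∑ b ∈ B k, g (b / scale N (k + 1)) := by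
  have hs : (scale N (k + 1) : ℝ) ≠ 0 := by exact_mod_cast (h.scale_pos (k + 1)).ne'
  have hinj : Function.Injective fun b : ℤ => (b : ℝ) / scale N (k + 1) := by
    intro b b' e
    have := (div_left_inj' hs).1 e
    exact_mod_cast this
  rw [factor, integral_uniformDirac, ← cast_scale, Finset.card_image_of_injective _ hinj,
    Finset.sum_image hinj.injOn]

lemma ae_factor (k : ℕ) : ∀ᵐ x ∂factor N B k,
    x ∈ Set.Icc 0 ((scale N k : ℝ)⁻¹ - (scale N (k + 1) : ℝ)⁻¹) := by
  refine ae_uniformDirac fun x hx => ?_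
  obtain ⟨b, hb, rfl⟩ := Finset.mem_image.1 hx
  obtain ⟨h0, h1⟩ := Finset.mem_Ico.1 (h.subset k hb)
  have hs : (0 : ℝ) < scale N k := by exact_mod_cast h.scale_pos k
  have hN : (0 : ℝ) < N k := by exact_mod_cast h.pos k
  rw [← cast_scale, scale_succ]
  push_cast
  have h0' : (0 : ℝ) ≤ b := by exact_mod_cast h0
  have h1' : (b : ℝ) + 1 ≤ N k := by exact_mod_cast h1
  refine ⟨by positivity, ?_⟩
  have e : (scale N k : ℝ)⁻¹ - (scale N k * N k : ℝ)⁻¹ = (N k - 1) / (scale N k * N k) := by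
    field_simp
  rw [e]
  gcongr
  linarith

lemma ae_digitLaw : ∀ᵐ x ∂digitLaw N B, ∀ k,
    x k ∈ Set.Icc 0 ((scale N k : ℝ)⁻¹ - (scale N (k + 1) : ℝ)⁻¹) := by
  have := h.isProbabilityMeasure_factor
  exact ae_mem_Icc_infinitePi h.ae_factor

lemma ae_summable : ∀ᵐ x ∂digitLaw N B, Summable x := by
  filter_upwards [h.ae_digitLaw] with x hx
  exact (summable_of_mem_Icc (n := 0) (by simpa using hx)).1

lemma ae_tailSum_mem (n : ℕ) : ∀ᵐ x ∂digitLaw N B, tailSum n x ∈ Set.Icc 0 (scale N n : ℝ)⁻¹ := by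
  filter_upwards [h.ae_digitLaw] with x hx
  exact (summable_of_mem_Icc (n := n) fun k => hx (n + k)).2

lemma ae_headSum_add_tailSum (n : ℕ) :
    ∀ᵐ x ∂digitLaw N B, headSum n x + tailSum n x = ∑' k, x k := by
  filter_upwards [h.ae_summable] with x hx
  rw [← hx.sum_add_tsum_nat_add n]
  simp [headSum, tailSum, add_comm]

lemma aemeasurable_tsum : AEMeasurable (fun x : ℕ → ℝ => ∑' k, x k) (digitLaw N B) :=
  aemeasurable_tsum_of_ae_summable h.ae_summable

/-- This places every tail measure on the one digit space, so that heads and tails can be compared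
there. -/
lemma map_shift (n : ℕ) : (digitLaw N B).map (fun x k => x (n + k)) =
    Measure.infinitePi fun k => factor N B (n + k) := by
  have := h.isProbabilityMeasure_factor
  exact Measure.map_infinitePi_infinitePi_of_inj (P := factor N B) (add_right_injective n)

lemma aemeasurable_tsum_shift (n : ℕ) : AEMeasurable (fun x : ℕ → ℝ => ∑' k, x k)
    (Measure.infinitePi fun k => factor N B (n + k)) := by
  have := h.isProbabilityMeasure_factor
  refine aemeasurable_tsum_of_ae_summable ?_
  filter_upwards [ae_mem_Icc_infinitePi fun k => h.ae_factor (n + k)] with x hx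
  exact (summable_of_mem_Icc hx).1

lemma aemeasurable_tailSum (n : ℕ) : AEMeasurable (tailSum n) (digitLaw N B) := by
  have h1 := h.aemeasurable_tsum_shift n
  rw [← h.map_shift n] at h1
  exact h1.comp_measurable (by fun_prop)

lemma integral_tail (n : ℕ) {g : ℝ → ℂ} (hg : Continuous g) :
    ∫ t, g t ∂tail N B n = ∫ x, g (tailSum n x) ∂digitLaw N B := by
  rw [tail, infiniteConv, integral_map (h.aemeasurable_tsum_shift n) hg.aestronglyMeasurable,
    ← h.map_shift n, integral_map]
  · rfl
  · exact Measurable.aemeasurable (by fun_prop)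
  · rw [h.map_shift n]
    exact hg.comp_aestronglyMeasurable (h.aemeasurable_tsum_shift n).aestronglyMeasurable

/-- `nu N B n` is the law of `scale N n` times the tail sum, so the two scalings cancel. -/
lemma fourierTransform_nu (n : ℕ) (ξ : ℝ) :
    fourierTransform (nu N B n) (ξ / scale N n) =
      ∫ x, ch (ξ * tailSum n x) ∂digitLaw N B := by
  have hs : (scale N n : ℝ) ≠ 0 := by exact_mod_cast (h.scale_pos n).ne'
  have hc := continuous_ch
  have e : ∀ x : ℝ, Complex.exp (-2 * Real.pi * Complex.I * ((ξ / scale N n : ℝ) : ℂ) * x) =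
      ch (ξ / scale N n * x) := by
    intro x
    rw [ch]
    congr 1
    push_cast
    ring
  rw [fourierTransform, nu]
  simp only [e, ← cast_scale]
  rw [integral_map (by fun_prop) (by fun_prop), ← h.integral_tail n (g := fun t => ch (ξ * t)) (by fun_prop)]
  refine integral_congr_ae (.of_forall fun x => ?_)
  dsimp only
  rw [← mul_assoc, div_mul_cancel₀ _ hs]

/-- The tail sum is at most `1 / scale N n` almost surely, so the integrand is close to `1`. This
lets frequencies already chosen stay unchanged at a much larger scale. -/
lemma norm_fourierTransform_nu_sub_one_le (n : ℕ) (ξ : ℝ) :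
    ‖fourierTransform (nu N B n) (ξ / scale N n) - 1‖ ≤ 2 * Real.pi * (|ξ| / scale N n) := by
  have := h.isProbabilityMeasure_digitLaw
  have hc := continuous_ch
  have hm := h.aemeasurable_tailSum n
  have hint : Integrable (fun x => ch (ξ * tailSum n x)) (digitLaw N B) := by
    refine Integrable.of_bound (C := 1) ?_ (.of_forall fun x => (norm_ch _).le)
    exact (hc.comp_aestronglyMeasurable (hm.const_mul ξ).aestronglyMeasurable)
  rw [h.fourierTransform_nu]
  have e : ∫ x, ch (ξ * tailSum n x) ∂digitLaw N B - 1 =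
      ∫ x, (ch (ξ * tailSum n x) - 1) ∂digitLaw N B := by
    rw [integral_sub hint (integrable_const _)]
    simp
  rw [e]
  refine (norm_integral_le_of_norm_le_const (C := 2 * Real.pi * (|ξ| / scale N n)) ?_).trans_eq
    (by simp)
  filter_upwards [h.ae_tailSum_mem n] with x hx
  refine (norm_ch_sub_one_le _).trans ?_
  rw [abs_mul, abs_of_nonneg hx.1, div_eq_mul_inv]
  gcongr
  exact hx.2

lemma iIndepFun_digits : iIndepFun (fun (k : ℕ) (x : ℕ → ℝ) => x k) (digitLaw N B) := by
  have := h.isProbabilityMeasure_factor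
  exact iIndepFun_infinitePi (X := fun _ y => y) fun _ => measurable_id

/-- Integrating out the last, independent digit replaces `g` by an average `G` of its translates.
The induction hypothesis is applied to `G`, hence the quantification over `g` inside the induction.
-/
lemma integral_headSum (n : ℕ) : ∀ {g : ℝ → ℂ}, Continuous g → (∃ C, ∀ t, ‖g t‖ ≤ C) →
    ∫ x, g (headSum n x) ∂digitLaw N B =
      ((digitSet N B n).card : ℂ)⁻¹ * ∑ a ∈ digitSet N B n, g (a / scale N n) := by
  have := h.isProbabilityMeasure_factor
  have := h.isProbabilityMeasure_digitLaw
  induction n with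
  | zero =>
    intro g _ _
    simp [headSum, digitSet]
  | succ n ih =>
    intro g hg ⟨C, hC⟩
    have hs : (scale N n : ℝ) ≠ 0 := by exact_mod_cast (h.scale_pos n).ne'
    have hN : (N n : ℝ) ≠ 0 := by exact_mod_cast (h.pos n).ne'
    have hind : IndepFun (headSum n) (fun x : ℕ → ℝ => x n) (digitLaw N B) := by
      have := h.iIndepFun_digits.indepFun_sum_range_succ (fun i => by fun_prop) n
      convert this using 1
      ext x
      simp [headSum]
    have hmap := hind.map_prod_eq_prod_map_map (measurable_headSum n).aemeasurable
      (measurable_pi_apply n).aemeasurable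
    rw [show (digitLaw N B).map (fun x : ℕ → ℝ => x n) = factor N B n from
      Measure.infinitePi_map_eval _ n] at hmap
    have hP : IsProbabilityMeasure ((digitLaw N B).map (headSum n)) :=
      Measure.isProbabilityMeasure_map (measurable_headSum n).aemeasurable
    set G : ℝ → ℂ := fun s => ∫ t, g (s + t) ∂factor N B n with hG
    have hG' : G = fun s => ((B n).card : ℂ)⁻¹ * ∑ b ∈ B n, g (s + b / scale N (n + 1)) := by
      ext s
      exact h.integral_factor n fun t => g (s + t)
    have hGc : Continuous G := by
      rw [hG']
      fun_prop
    have hGb : ∀ s, ‖G s‖ ≤ C := fun s =>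
      (norm_integral_le_of_norm_le_const (C := C) (.of_forall fun t => hC _)).trans_eq (by simp)
    have hmeas : Measurable fun x : ℕ → ℝ => (headSum n x, x n) :=
      (measurable_headSum n).prodMk (measurable_pi_apply n)
    have hgm : Measurable fun p : ℝ × ℝ => g (p.1 + p.2) := by fun_prop
    calc ∫ x, g (headSum (n + 1) x) ∂digitLaw N B
        = ∫ x, g (headSum n x + x n) ∂digitLaw N B := by simp [headSum, Finset.sum_range_succ]
      _ = ∫ p, g (p.1 + p.2) ∂(digitLaw N B).map fun x => (headSum n x, x n) := by
          rw [integral_map hmeas.aemeasurable hgm.aestronglyMeasurable]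
      _ = ∫ s, G s ∂(digitLaw N B).map (headSum n) := by
          rw [hmap, integral_prod]
          exact Integrable.of_bound hgm.aestronglyMeasurable C (.of_forall fun p => hC _)
      _ = ∫ x, G (headSum n x) ∂digitLaw N B := by
          rw [integral_map (measurable_headSum n).aemeasurable hGc.aestronglyMeasurable]
      _ = _ := by
          rw [ih hGc ⟨C, hGb⟩, hG', digitSet,
            card_radixSum (incongr_of_subset_Ico (h.subset n)) (h.pos n),
            sum_radixSum (incongr_of_subset_Ico (h.subset n)) (h.pos n), ← Finset.mul_sum,
            ← mul_assoc, ← mul_inv, Nat.cast_mul]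
          congr 1
          refine Finset.sum_congr rfl fun a _ => Finset.sum_congr rfl fun b _ => ?_
          congr 1
          rw [scale_succ]
          push_cast
          field_simp

/-- Finite pieces `T m` of the tail use digits disjoint from those of the head, so they are
independent of it; the product formula passes to the limit by dominated convergence. -/
lemma integral_headSum_mul_tailSum (n : ℕ) {g : ℝ → ℂ} (hg : Continuous g)
    (hb : ∃ C, ∀ t, ‖g t‖ ≤ C) (ξ : ℝ) :
    ∫ x, g (headSum n x) * ch (ξ * tailSum n x) ∂digitLaw N B =
      (∫ x, g (headSum n x) ∂digitLaw N B) * ∫ x, ch (ξ * tailSum n x) ∂digitLaw N B := by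
  have := h.isProbabilityMeasure_digitLaw
  have hc := continuous_ch
  obtain ⟨C, hC⟩ := hb
  set T : ℕ → (ℕ → ℝ) → ℝ := fun m x => ∑ k ∈ Finset.range m, x (n + k) with hT
  have hTm : ∀ m, Measurable (T m) := fun m => by fun_prop
  have hlim : ∀ᵐ x ∂digitLaw N B, Tendsto (fun m => ch (ξ * T m x)) atTop
      (𝓝 (ch (ξ * tailSum n x))) := by
    filter_upwards [h.ae_digitLaw] with x hx
    have h1 := (summable_of_mem_Icc (n := n) fun k => hx (n + k)).1.hasSum.tendsto_sum_nat
    exact (hc.tendsto _).comp (h1.const_mul ξ)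
  have hind : ∀ m, IndepFun (headSum n) (T m) (digitLaw N B) := by
    intro m
    have h1 := h.iIndepFun_digits.indepFun_finset (Finset.range n) (Finset.Ico n (n + m))
      (by
        rw [Finset.disjoint_left]
        intro k hk hk'
        simp only [Finset.mem_range, Finset.mem_Ico] at hk hk'
        omega) fun i => by fun_prop
    have h2 := h1.comp (φ := fun y => ∑ i, y i) (ψ := fun y => ∑ i, y i) (by fun_prop)
      (by fun_prop)
    convert h2 using 1
    · ext x
      exact (Finset.sum_coe_sort (Finset.range n) x).symm
    · ext x
      simp only [hT, Function.comp_apply]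
      rw [Finset.sum_coe_sort (Finset.Ico n (n + m)) x, Finset.sum_Ico_eq_sum_range]
      simp
  have hgm : Measurable fun x => g (headSum n x) := hg.measurable.comp (measurable_headSum n)
  have hl : Tendsto (fun m => ∫ x, g (headSum n x) * ch (ξ * T m x) ∂digitLaw N B) atTop
      (𝓝 (∫ x, g (headSum n x) * ch (ξ * tailSum n x) ∂digitLaw N B)) := by
    refine tendsto_integral_of_dominated_convergence (fun _ => C) (fun m => ?_)
      (integrable_const _) (fun m => .of_forall fun x => ?_) ?_
    · exact (hgm.mul (hc.measurable.comp ((hTm m).const_mul ξ))).aestronglyMeasurable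
    · rw [norm_mul, norm_ch, mul_one]
      exact hC _
    · filter_upwards [hlim] with x hx
      exact hx.const_mul _
  have hr : Tendsto (fun m => ∫ x, ch (ξ * T m x) ∂digitLaw N B) atTop
      (𝓝 (∫ x, ch (ξ * tailSum n x) ∂digitLaw N B)) := by
    refine tendsto_integral_of_dominated_convergence (fun _ => 1) (fun m => ?_)
      (integrable_const _) (fun m => .of_forall fun x => ?_) hlim
    · exact (hc.measurable.comp ((hTm m).const_mul ξ)).aestronglyMeasurable
    · rw [norm_ch]
  refine tendsto_nhds_unique hl ((hr.const_mul _).congr fun m => ?_)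
  have hm : Measurable fun t => ch (ξ * t) := by fun_prop
  exact ((hind m).integral_fun_comp_mul_comp (measurable_headSum n).aemeasurable
    (hTm m).aemeasurable hg.aestronglyMeasurable hm.aestronglyMeasurable).symm

end IsAdmissible

/-! ### Choice of the frequencies by equi-positivity -/

lemma isFrameLevel_zero (N : ℕ → ℕ) (B : ℕ → Finset ℤ) :
    IsFrameLevel (scale N 0) (digitSet N B 0) {0} 1 1 := by
  refine ⟨by simp, fun w => ?_, fun w => ?_⟩ <;> simp [digitSet, norm_ch]

/-- A frame tower: all `(N n, B n, L n)` are frame levels with `0 ∈ L n`, and the products of their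
bounds stay in `[c₀, C₀]`. -/
structure IsFrameTower (N : ℕ → ℕ) (B L : ℕ → Finset ℤ) (c C : ℕ → ℝ) (c₀ C₀ : ℝ) : Prop where
  level : ∀ n, IsFrameLevel (N n) (B n) (L n) (c n) (C n)
  zero_mem : ∀ n, (0 : ℤ) ∈ L n
  nonneg : ∀ n, 0 ≤ c n
  nonneg' : ∀ n, 0 ≤ C n
  pos : 0 < c₀
  le_prod : ∀ n, c₀ ≤ ∏ i ∈ Finset.range n, c i
  prod_le : ∀ n, ∏ i ∈ Finset.range n, C i ≤ C₀

/-- The frame level condition for the first `n` factors of a tower. -/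
def IsTowerLevel (N : ℕ → ℕ) (B : ℕ → Finset ℤ) (c C : ℕ → ℝ) (n : ℕ) (Λ : Finset ℤ) : Prop :=
  IsFrameLevel (scale N n) (digitSet N B n) Λ (∏ i ∈ Finset.range n, c i)
    (∏ i ∈ Finset.range n, C i)

namespace IsAdmissible

variable {N : ℕ → ℕ} {B L : ℕ → Finset ℤ} {c C : ℕ → ℝ} {c₀ C₀ : ℝ} (h : IsAdmissible N B)
  (hT : IsFrameTower N B L c C c₀ C₀)
include h hT

/-- Because `0 ∈ L n` at every level, the new high part of a frequency may be zero, so the old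
frequencies survive composition. -/
lemma exists_extension {n : ℕ} {Λ : Finset ℤ} (hΛ : IsTowerLevel N B c C n Λ) (m : ℕ) :
    ∃ Λ', Λ ⊆ Λ' ∧ IsTowerLevel N B c C (n + m) Λ' := by
  induction m with
  | zero => exact ⟨Λ, subset_rfl, hΛ⟩
  | succ m ih =>
    obtain ⟨Λ', hsub, hΛ'⟩ := ih
    refine ⟨radixSum (scale N (n + m)) (L (n + m)) Λ', fun l hl => ?_, ?_⟩
    · exact Finset.mem_image.2 ⟨(0, l),
        Finset.mem_product.2 ⟨hT.zero_mem _, hsub hl⟩, by simp⟩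
    · have := IsFrameLevel.comp hΛ' (hT.level (n + m)) (incongr_of_subset_Ico (h.subset _))
        (h.scale_pos _) (h.pos _) (hT.nonneg _) (hT.nonneg' _)
      rwa [← scale_succ, ← Finset.prod_range_succ, ← Finset.prod_range_succ] at this

/-- The inductive step of the construction: keep `Λ`, where a large scale makes the tail transform
at least `1 / 2`, and move all other frequencies modulo the scale by equi-positivity. -/
lemma exists_next {s : ℕ → ℕ} (hs : StrictMono s) {ε₀ : ℝ}
    (hε : ∀ x ∈ Set.Icc (0 : ℝ) 1, ∀ ν ∈ Set.range fun k => nu N B (s k), ∃ k : ℤ,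
      ε₀ ≤ ‖fourierTransform ν (x + k)‖)
    {n : ℕ} {Λ : Finset ℤ} (hΛ : IsTowerLevel N B c C n Λ) :
    ∃ n' Λ', n < n' ∧ Λ ⊆ Λ' ∧ IsTowerLevel N B c C n' Λ' ∧
      ∀ l ∈ Λ', min ε₀ (1 / 2) ≤ ‖fourierTransform (nu N B n') (l / scale N n')‖ := by
  -- Chosen so that `2π|l| / scale N n' ≤ 1 / 2` for all `l ∈ Λ`, as the scale is at least `2 ^ k₀`.
  obtain ⟨k₀, hk₀⟩ := pow_unbounded_of_one_lt (4 * Real.pi * ∑ l ∈ Λ, |(l : ℝ)|) one_lt_two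
  set k := max k₀ (n + 1) with hk
  set n' := s k with hn'
  have hkn : k ≤ n' := hs.le_apply
  have hnn' : n < n' := by omega
  have hMp : 0 < scale N n' := h.scale_pos n'
  have hM : (0 : ℝ) < scale N n' := by exact_mod_cast hMp
  have hsmall : ∀ l ∈ Λ, 1 / 2 ≤ ‖fourierTransform (nu N B n') (l / scale N n')‖ := by
    intro l hl
    have h1 := h.norm_fourierTransform_nu_sub_one_le n' l
    have h2 : |(l : ℝ)| ≤ ∑ l ∈ Λ, |(l : ℝ)| :=
      Finset.single_le_sum (f := fun l : ℤ => |(l : ℝ)|) (fun _ _ => abs_nonneg _) hl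
    have h3 : (2 : ℝ) ^ k₀ ≤ scale N n' := by
      have : 2 ^ k₀ ≤ scale N n' :=
        (Nat.pow_le_pow_right two_pos (by omega)).trans (h.two_pow_le_scale n')
      exact_mod_cast this
    have h4 : 2 * Real.pi * (|(l : ℝ)| / scale N n') ≤ 1 / 2 := by
      rw [← mul_div_assoc, div_le_iff₀ hM]
      nlinarith [Real.pi_pos]
    have h5 := norm_sub_norm_le (1 : ℂ) (1 - fourierTransform (nu N B n') (l / scale N n'))
    rw [sub_sub_cancel, norm_one, norm_sub_rev] at h5
    linarith
  have hex : ∀ l : ℤ, ∃ j : ℤ, (l ∈ Λ → j = 0) ∧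
      min ε₀ (1 / 2) ≤ ‖fourierTransform (nu N B n') ((l + scale N n' * j : ℤ) / scale N n')‖ := by
    intro l
    by_cases hl : l ∈ Λ
    · exact ⟨0, fun _ => rfl, (min_le_right _ _).trans (by simpa using hsmall l hl)⟩
    -- Equi-positivity only covers `[0, 1]`, so it is applied to the fractional part; the floor is
    -- absorbed in the integer shift.
    · obtain ⟨j, hj⟩ := hε (Int.fract ((l : ℝ) / scale N n'))
        ⟨Int.fract_nonneg _, (Int.fract_lt_one _).le⟩ _ ⟨k, rfl⟩
      refine ⟨j - ⌊(l : ℝ) / scale N n'⌋, fun h => absurd h hl, (min_le_left _ _).trans ?_⟩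
      refine hj.trans (le_of_eq ?_)
      congr 2
      rw [Int.fract]
      push_cast
      field_simp
      ring
  choose j hj0 hj using hex
  obtain ⟨Λ₁, hsub, hΛ₁⟩ := h.exists_extension hT hΛ (n' - n)
  rw [Nat.add_sub_cancel' hnn'.le] at hΛ₁
  refine ⟨n', Λ₁.image fun l => l + scale N n' * j l, hnn', fun l hl => ?_,
    IsFrameLevel.shift hΛ₁ hMp j, fun x hx => ?_⟩
  · exact Finset.mem_image.2 ⟨l, hsub hl, by simp [hj0 l hl]⟩
  · obtain ⟨l, -, rfl⟩ := Finset.mem_image.1 hx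
    exact hj l

/-- Under equi-positivity, frame levels may be chosen to increase, with Fourier transforms of the
tails bounded below on them. -/
lemma exists_levels {s : ℕ → ℕ} (hs : StrictMono s)
    (hpos : EquiPositive (Set.range fun k => nu N B (s k))) :
    ∃ δ : ℝ, 0 < δ ∧ ∃ (n : ℕ → ℕ) (Λ : ℕ → Finset ℤ), StrictMono n ∧ Monotone Λ ∧
      (∀ k, IsTowerLevel N B c C (n k) (Λ k)) ∧
      ∀ k, ∀ l ∈ Λ k, δ ≤ ‖fourierTransform (nu N B (n k)) (l / scale N (n k))‖ := by
  obtain ⟨ε₀, hε₀, hε⟩ := hpos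
  refine ⟨min ε₀ (1 / 2), by positivity, ?_⟩
  have hex : ∀ p : {p : ℕ × Finset ℤ // IsTowerLevel N B c C p.1 p.2},
      ∃ q : {p : ℕ × Finset ℤ // IsTowerLevel N B c C p.1 p.2}, p.1.1 < q.1.1 ∧ p.1.2 ⊆ q.1.2 ∧
      ∀ l ∈ q.1.2, min ε₀ (1 / 2) ≤ ‖fourierTransform (nu N B q.1.1) (l / scale N q.1.1)‖ := by
    rintro ⟨⟨n, Λ⟩, hp⟩
    obtain ⟨n', Λ', h1, h2, h3, h4⟩ := h.exists_next hT hs hε hp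
    exact ⟨⟨⟨n', Λ'⟩, h3⟩, h1, h2, h4⟩
  choose next h1 h2 h3 using hex
  have h0 : IsTowerLevel N B c C 0 {0} := by
    simpa [IsTowerLevel] using isFrameLevel_zero N B
  -- The iteration starts at `k + 1` because the lower bound on the tail transform is supplied only
  -- for outputs of `next`.
  set p := fun k => next^[k + 1] ⟨⟨0, {0}⟩, h0⟩ with hp
  have hsucc : ∀ k, p (k + 1) = next (p k) := fun k => Function.iterate_succ_apply' _ _ _
  refine ⟨fun k => (p k).1.1, fun k => (p k).1.2, strictMono_nat_of_lt_succ fun k => ?_,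
    monotone_nat_of_le_succ fun k => ?_, fun k => (p k).2, fun k => ?_⟩
  · rw [hsucc]
    exact h1 _
  · rw [hsucc]
    exact h2 _
  · simp only [hp, Function.iterate_succ_apply']
    exact h3 _

end IsAdmissible

/-! ### Uniform bounds for the products of the constants -/

/-- The products of `(1 - ε i)²` and of `(1 + ε i)²` are bounded below and above. -/
lemma exists_prod_bounds {ε : ℕ → ℝ} (hε : ∀ n, 0 ≤ ε n ∧ ε n < 1) (hs : Summable ε) :
    ∃ c₀ C₀ : ℝ, 0 < c₀ ∧ (∀ n, c₀ ≤ ∏ i ∈ Finset.range n, (1 - ε i) ^ 2) ∧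
      ∀ n, ∏ i ∈ Finset.range n, (1 + ε i) ^ 2 ≤ C₀ := by
  have hp : ∀ n, 0 < ∏ i ∈ Finset.range n, (1 - ε i) := fun n =>
    Finset.prod_pos fun i _ => sub_pos.2 (hε i).2
  have hle : ∀ i, 1 - ε i ≤ 1 := fun i => sub_le_self _ (hε i).1
  have hanti : Antitone fun n => ∏ i ∈ Finset.range n, (1 - ε i) := by
    refine antitone_nat_of_succ_le fun n => ?_
    rw [Finset.prod_range_succ]
    exact mul_le_of_le_one_right (hp n).le (hle n)
  obtain ⟨m, hm⟩ : ∃ m, ∀ n, ∑ i ∈ Finset.range n, ε (m + i) ≤ 1 / 2 := by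
    have ht := (tendsto_sum_nat_add ε).eventually (gt_mem_nhds (show (0 : ℝ) < 1 / 2 by norm_num))
    obtain ⟨m, hm⟩ := ht.exists
    refine ⟨m, fun n => ?_⟩
    have := ((summable_nat_add_iff m).2 hs).sum_le_tsum (Finset.range n) fun i _ => (hε _).1
    simp only [add_comm m]
    linarith
  -- Beyond an index `m` where the remaining sum is at most `1 / 2`, this inequality keeps the
  -- partial products above `1 / 2`; the first `m` factors contribute a fixed positive number.
  have hhalf : ∀ n, 1 - ∑ i ∈ Finset.range n, ε (m + i) ≤
      ∏ i ∈ Finset.range n, (1 - ε (m + i)) := by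
    intro n
    induction n with
    | zero => simp
    | succ n ih =>
      rw [Finset.sum_range_succ, Finset.prod_range_succ]
      have h1 : ∏ i ∈ Finset.range n, (1 - ε (m + i)) ≤ 1 :=
        Finset.prod_le_one (fun i _ => (sub_pos.2 (hε _).2).le) fun i _ => hle _
      have := (hε (m + n)).1
      nlinarith
  refine ⟨((∏ i ∈ Finset.range m, (1 - ε i)) * (1 / 2)) ^ 2, Real.exp (∑' i, ε i) ^ 2,
    pow_pos (mul_pos (hp m) (by norm_num)) 2, fun n => ?_, fun n => ?_⟩
  · rw [Finset.prod_pow]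
    refine pow_le_pow_left₀ (mul_pos (hp m) (by norm_num)).le ?_ 2
    refine le_trans ?_ (hanti (Nat.le_add_left n m))
    dsimp only
    rw [Finset.prod_range_add]
    refine mul_le_mul_of_nonneg_left ?_ (hp m).le
    linarith [hhalf n, hm n]
  · rw [Finset.prod_pow]
    refine pow_le_pow_left₀ (Finset.prod_nonneg fun i _ => by linarith [(hε i).1]) ?_ 2
    calc ∏ i ∈ Finset.range n, (1 + ε i) ≤ ∏ i ∈ Finset.range n, Real.exp (ε i) := by
          refine Finset.prod_le_prod (fun i _ => by linarith [(hε i).1]) fun i _ => ?_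
          linarith [Real.add_one_le_exp (ε i)]
      _ = Real.exp (∑ i ∈ Finset.range n, ε i) := (Real.exp_sum _ _).symm
      _ ≤ _ := Real.exp_le_exp.2 (hs.sum_le_tsum _ fun i _ => (hε i).1)

/-! ### Passage to the limit: Bessel inequality and lower frame bound -/

lemma IsFrameLevel.mono {M : ℕ} {A Λ : Finset ℤ} {c C c' C' : ℝ} (h : IsFrameLevel M A Λ c C)
    (hc : c' ≤ c) (hC : C ≤ C') : IsFrameLevel M A Λ c' C' :=
  ⟨h.incongr, fun w => (mul_le_mul_of_nonneg_right hc (by positivity)).trans (h.lower w),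
    fun w => (h.upper w).trans (mul_le_mul_of_nonneg_right hC (by positivity))⟩

/-- The Cauchy-Schwarz inequality for integrals. -/
lemma norm_integral_mul_sq_le {Ω : Type*} [MeasurableSpace Ω] {P : Measure Ω} {f g : Ω → ℂ}
    (hf : MemLp f 2 P) (hg : MemLp g 2 P) :
    ‖∫ x, f x * g x ∂P‖ ^ 2 ≤ (∫ x, ‖f x‖ ^ 2 ∂P) * ∫ x, ‖g x‖ ^ 2 ∂P := by
  have h1 : ‖∫ x, f x * g x ∂P‖ ≤ ∫ x, ‖f x‖ * ‖g x‖ ∂P :=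
    (norm_integral_le_integral_norm _).trans_eq (by simp)
  have h2 := integral_mul_norm_le_Lp_mul_Lq (μ := P) (f := f) (g := g) (p := 2) (q := 2)
    Real.HolderConjugate.two_two (by simpa using hf) (by simpa using hg)
  have h3 := pow_le_pow_left₀ (norm_nonneg _) (h1.trans h2) 2
  refine h3.trans_eq ?_
  rw [mul_pow, ← Real.sqrt_eq_rpow, ← Real.sqrt_eq_rpow, Real.sq_sqrt, Real.sq_sqrt]
  · simp
  · exact integral_nonneg fun x => by positivity
  · exact integral_nonneg fun x => by positivity

lemma norm_sq_le_two_mul (u v : ℂ) : ‖u‖ ^ 2 ≤ 2 * ‖v‖ ^ 2 + 2 * ‖u - v‖ ^ 2 := by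
  have h1 : ‖u‖ ≤ ‖v‖ + ‖u - v‖ := by
    simpa using norm_add_le v (u - v)
  nlinarith [sq_nonneg (‖v‖ - ‖u - v‖), norm_nonneg u]

/-- Increasing finite frame levels for the truncations of a Cantor-Moran measure, such that the
Fourier transforms of the tails are bounded below at the frequencies. -/
structure IsLevelSequence (N : ℕ → ℕ) (B : ℕ → Finset ℤ) (c C δ : ℝ) (n : ℕ → ℕ)
    (Λ : ℕ → Finset ℤ) : Prop where
  strictMono : StrictMono n
  monotone : Monotone Λ
  level : ∀ k, IsFrameLevel (scale N (n k)) (digitSet N B (n k)) (Λ k) c C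
  le_norm : ∀ k, ∀ l ∈ Λ k, δ ≤ ‖fourierTransform (nu N B (n k)) (l / scale N (n k))‖

namespace IsAdmissible

variable {N : ℕ → ℕ} {B : ℕ → Finset ℤ} (h : IsAdmissible N B)
include h

omit h in
lemma tendsto_headSum {x : ℕ → ℝ} (hx : Summable x) {n : ℕ → ℕ} (hn : StrictMono n) :
    Tendsto (fun k => headSum (n k) x) atTop (𝓝 (∑' k, x k)) :=
  hx.hasSum.tendsto_sum_nat.comp hn.tendsto_atTop

lemma zero_mem_digitSet (n : ℕ) : (0 : ℤ) ∈ digitSet N B n := by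
  induction n with
  | zero => simp [digitSet]
  | succ n ih =>
    exact Finset.mem_image.2 ⟨(0, 0), Finset.mem_product.2 ⟨ih, h.zero_mem n⟩, by simp⟩

lemma card_digitSet_pos (n : ℕ) : (0 : ℝ) < (digitSet N B n).card := by
  exact_mod_cast Finset.card_pos.2 ⟨0, h.zero_mem_digitSet n⟩

lemma integral_norm_sq_headSum (n : ℕ) {g : ℝ → ℂ} (hg : Continuous g) (hb : ∃ C, ∀ t, ‖g t‖ ≤ C) :
    ∫ x, ‖g (headSum n x)‖ ^ 2 ∂digitLaw N B =
      ((digitSet N B n).card : ℝ)⁻¹ * ∑ a ∈ digitSet N B n, ‖g (a / scale N n)‖ ^ 2 := by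
  obtain ⟨C, hC⟩ := hb
  have := h.integral_headSum n (g := fun t => ((‖g t‖ ^ 2 : ℝ) : ℂ)) (by fun_prop)
    ⟨C ^ 2, fun t => by
      rw [Complex.norm_real, norm_pow, norm_norm]
      exact pow_le_pow_left₀ (norm_nonneg _) (hC t) 2⟩
  refine Complex.ofReal_injective ?_
  rw [← integral_complex_ofReal, this]
  push_cast
  rfl

variable {c C δ : ℝ} {n : ℕ → ℕ} {Λ : ℕ → Finset ℤ} (hΛ : IsLevelSequence N B c C δ n Λ)
include hΛ

/-- The dual form of the Bessel inequality for the limit measure. -/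
lemma integral_trigPoly_le (hC : 0 ≤ C) {k : ℕ} {F : Finset ℤ} (hF : F ⊆ Λ k) (z : ℤ → ℂ) :
    ∫ x, ‖∑ l ∈ F, z l * ch (l * ∑' i, x i)‖ ^ 2 ∂digitLaw N B ≤ C * ∑ l ∈ F, ‖z l‖ ^ 2 := by
  have := h.isProbabilityMeasure_digitLaw
  have hc := continuous_ch
  set q : ℝ → ℂ := fun t => ∑ l ∈ F, z l * ch (l * t) with hq
  have hqc : Continuous q := by fun_prop
  have hqb : ∀ t, ‖q t‖ ≤ ∑ l ∈ F, ‖z l‖ := fun t =>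
    (norm_sum_le _ _).trans_eq (by simp [norm_ch])
  have hlim : Tendsto (fun j => ∫ x, ‖q (headSum (n j) x)‖ ^ 2 ∂digitLaw N B) atTop
      (𝓝 (∫ x, ‖q (∑' i, x i)‖ ^ 2 ∂digitLaw N B)) := by
    refine tendsto_integral_of_dominated_convergence (fun _ => (∑ l ∈ F, ‖z l‖) ^ 2)
      (fun j => ?_) (integrable_const _) (fun j => .of_forall fun x => ?_) ?_
    · exact ((hqc.norm.pow 2).measurable.comp (measurable_headSum _)).aestronglyMeasurable
    · rw [norm_pow, norm_norm]
      exact pow_le_pow_left₀ (norm_nonneg _) (hqb _) 2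
    · filter_upwards [h.ae_summable] with x hx
      exact ((hqc.norm.pow 2).tendsto _).comp (tendsto_headSum hx hΛ.strictMono)
  -- For `j ≥ k` monotonicity gives `F ⊆ Λ j`, so the finite dual bound applies with the same
  -- constant at all these levels.
  refine le_of_tendsto hlim (eventually_atTop.2 ⟨k, fun j hj => ?_⟩)
  rw [h.integral_norm_sq_headSum (n j) hqc ⟨_, hqb⟩, inv_mul_le_iff₀ (h.card_digitSet_pos _)]
  have h1 := (hΛ.level j).dual hC (hF.trans (hΛ.monotone hj)) z
  have h2 : ∀ a l : ℤ, (l : ℝ) * (a / scale N (n j)) = a * l / scale N (n j) := fun a l => by ring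
  simp only [hq, h2]
  linarith

/-- The Bessel inequality on the digit space. -/
lemma bessel_digitLaw (hC : 0 ≤ C) {k : ℕ} {F : Finset ℤ} (hF : F ⊆ Λ k) {f : (ℕ → ℝ) → ℂ}
    (hf : MemLp f 2 (digitLaw N B)) :
    ∑ l ∈ F, ‖∫ x, f x * ch (l * ∑' i, x i) ∂digitLaw N B‖ ^ 2 ≤
      C * ∫ x, ‖f x‖ ^ 2 ∂digitLaw N B := by
  have := h.isProbabilityMeasure_digitLaw
  have hX := h.aemeasurable_tsum
  set T : ℤ → ℂ := fun l => ∫ x, f x * ch (l * ∑' i, x i) ∂digitLaw N B with hT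
  set S := ∑ l ∈ F, ‖T l‖ ^ 2 with hS
  have hS0 : 0 ≤ S := by positivity
  refine le_mul_of_sq_le hC (by positivity) ?_
  have hchm : ∀ l : ℤ, AEStronglyMeasurable (fun x : ℕ → ℝ => ch (l * ∑' i, x i)) (digitLaw N B) :=
    fun l => continuous_ch.comp_aestronglyMeasurable (hX.const_mul _).aestronglyMeasurable
  have hchL : ∀ l : ℤ, MemLp (fun x : ℕ → ℝ => ch (l * ∑' i, x i)) 2 (digitLaw N B) := fun l =>
    MemLp.of_bound (hchm l) 1 (.of_forall fun x => (norm_ch _).le)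
  have hgL : MemLp (fun x : ℕ → ℝ => ∑ l ∈ F, starRingEnd ℂ (T l) * ch (l * ∑' i, x i)) 2
      (digitLaw N B) := memLp_finsetSum _ fun l _ => (hchL l).const_mul _
  have h1 : (S : ℂ) = ∫ x, f x * ∑ l ∈ F, starRingEnd ℂ (T l) * ch (l * ∑' i, x i)
      ∂digitLaw N B := by
    have hi : ∀ l ∈ F, Integrable (fun x : ℕ → ℝ =>
        f x * (starRingEnd ℂ (T l) * ch (l * ∑' i, x i))) (digitLaw N B) := fun l _ =>
      hf.integrable_mul ((hchL l).const_mul _)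
    simp only [Finset.mul_sum]
    rw [integral_finsetSum _ hi, hS]
    push_cast
    refine Finset.sum_congr rfl fun l _ => ?_
    rw [← Complex.conj_mul', hT, ← integral_const_mul]
    exact integral_congr_ae (.of_forall fun x => by dsimp only; ring)
  have h2 : S ^ 2 = ‖(S : ℂ)‖ ^ 2 := by rw [Complex.norm_real, Real.norm_of_nonneg hS0]
  rw [h2, h1]
  refine (norm_integral_mul_sq_le hf hgL).trans ?_
  refine mul_le_mul_of_nonneg_left ?_ (by positivity)
  refine (h.integral_trigPoly_le hΛ hC hF fun l => starRingEnd ℂ (T l)).trans_eq ?_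
  simp [hS]

/-- The lower frame bound for bounded continuous functions. -/
lemma lower_of_continuous (hC : 0 ≤ C) (hδ : 0 ≤ δ) {g : ℝ → ℂ} (hg : Continuous g)
    (hb : ∃ K, ∀ t, ‖g t‖ ≤ K) {S : ℝ}
    (hS : ∀ k, ∑ l ∈ Λ k, ‖∫ x, g (∑' i, x i) * ch (l * ∑' i, x i) ∂digitLaw N B‖ ^ 2 ≤ S) :
    δ ^ 2 * c * ∫ x, ‖g (∑' i, x i)‖ ^ 2 ∂digitLaw N B ≤ 2 * S := by
  have := h.isProbabilityMeasure_digitLaw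
  have hch := continuous_ch
  have hX := h.aemeasurable_tsum
  obtain ⟨K, hK⟩ := hb
  have hgX : AEStronglyMeasurable (fun x : ℕ → ℝ => g (∑' i, x i)) (digitLaw N B) :=
    hg.comp_aestronglyMeasurable hX.aestronglyMeasurable
  have hgn : ∀ k, AEStronglyMeasurable (fun x => g (headSum (n k) x)) (digitLaw N B) := fun k =>
    (hg.measurable.comp (measurable_headSum _)).aestronglyMeasurable
  have hgXL : MemLp (fun x : ℕ → ℝ => g (∑' i, x i)) 2 (digitLaw N B) :=
    MemLp.of_bound hgX K (.of_forall fun x => hK _)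
  have hgnL : ∀ k, MemLp (fun x => g (headSum (n k) x)) 2 (digitLaw N B) := fun k =>
    MemLp.of_bound (hgn k) K (.of_forall fun x => hK _)
  have hlim1 : Tendsto (fun k => ∫ x, ‖g (headSum (n k) x)‖ ^ 2 ∂digitLaw N B) atTop
      (𝓝 (∫ x, ‖g (∑' i, x i)‖ ^ 2 ∂digitLaw N B)) := by
    refine tendsto_integral_of_dominated_convergence (fun _ => K ^ 2)
      (fun k => (hgn k).norm.pow 2) (integrable_const _) (fun k => .of_forall fun x => ?_) ?_
    · rw [norm_pow, norm_norm]
      exact pow_le_pow_left₀ (norm_nonneg _) (hK _) 2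
    · filter_upwards [h.ae_summable] with x hx
      exact ((hg.norm.pow 2).tendsto _).comp (tendsto_headSum hx hΛ.strictMono)
  have hlim2 : Tendsto (fun k => ∫ x, ‖g (headSum (n k) x) - g (∑' i, x i)‖ ^ 2 ∂digitLaw N B) atTop
      (𝓝 0) := by
    rw [← integral_zero (ℕ → ℝ) ℝ (μ := digitLaw N B)]
    refine tendsto_integral_of_dominated_convergence (fun _ => (2 * K) ^ 2)
      (fun k => ((hgn k).sub hgX).norm.pow 2) (integrable_const _)
      (fun k => .of_forall fun x => ?_) ?_
    · rw [norm_pow, norm_norm]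
      refine pow_le_pow_left₀ (norm_nonneg _) ((norm_sub_le _ _).trans ?_) 2
      linarith [hK (headSum (n k) x), hK (∑' i, x i)]
    · filter_upwards [h.ae_summable] with x hx
      have h1 := (hg.tendsto _).comp (tendsto_headSum hx hΛ.strictMono)
      simpa using ((h1.sub_const (g (∑' i, x i))).norm.pow 2)
  -- The character is evaluated at the full sum but `g` only at the head sum. The mixed coefficients
  -- are bounded below through the finite level, and differ from the true ones by coefficients of
  -- `g(head) - g(sum)`, whose square sum Bessel controls.
  have hstep : ∀ k, δ ^ 2 * c * ∫ x, ‖g (headSum (n k) x)‖ ^ 2 ∂digitLaw N B ≤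
      2 * S + 2 * (C * ∫ x, ‖g (headSum (n k) x) - g (∑' i, x i)‖ ^ 2 ∂digitLaw N B) := by
    intro k
    have hA := h.card_digitSet_pos (n k)
    set A := digitSet N B (n k) with hAdef
    set M := scale N (n k) with hM
    have hcoef : ∀ l ∈ Λ k, δ ^ 2 * ‖(A.card : ℂ)⁻¹ * ∑ a ∈ A, g (a / M) * ch (a * l / M)‖ ^ 2 ≤
        ‖∫ x, g (headSum (n k) x) * ch (l * ∑' i, x i) ∂digitLaw N B‖ ^ 2 := by
      intro l hl
      have hgl : Continuous fun t => g t * ch (l * t) := by fun_prop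
      have hglb : ∃ K, ∀ t, ‖g t * ch (l * t)‖ ≤ K :=
        ⟨K, fun t => by rw [norm_mul, norm_ch, mul_one]; exact hK t⟩
      -- The character splits over head plus tail, and independence factors the integral into a
      -- finite coefficient and the tail transform.
      have e1 : ∫ x, g (headSum (n k) x) * ch (l * ∑' i, x i) ∂digitLaw N B =
          ((A.card : ℂ)⁻¹ * ∑ a ∈ A, g (a / M) * ch (a * l / M)) *
            fourierTransform (nu N B (n k)) (l / M) := by
        have e2 : ∀ a : ℤ, ch (a * l / M) = ch (l * (a / M)) := fun a => by
          congr 1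
          ring
        simp only [e2]
        rw [h.fourierTransform_nu, ← h.integral_headSum (n k) hgl hglb,
          ← h.integral_headSum_mul_tailSum (n k) hgl hglb]
        refine integral_congr_ae ?_
        filter_upwards [h.ae_headSum_add_tailSum (n k)] with x hx
        rw [← hx, mul_add, ch_add, mul_assoc]
      rw [e1, norm_mul _ (fourierTransform _ _), mul_pow, mul_comm (δ ^ 2)]
      gcongr
      exact hΛ.le_norm k l hl
    have hsplit : ∀ l : ℤ, ‖∫ x, g (headSum (n k) x) * ch (l * ∑' i, x i) ∂digitLaw N B‖ ^ 2 ≤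
        2 * ‖∫ x, g (∑' i, x i) * ch (l * ∑' i, x i) ∂digitLaw N B‖ ^ 2 +
        2 * ‖∫ x, (g (headSum (n k) x) - g (∑' i, x i)) * ch (l * ∑' i, x i)
          ∂digitLaw N B‖ ^ 2 := by
      intro l
      have hchm : AEStronglyMeasurable (fun x : ℕ → ℝ => ch (l * ∑' i, x i)) (digitLaw N B) :=
        hch.comp_aestronglyMeasurable (hX.const_mul _).aestronglyMeasurable
      have hi : ∀ {f : (ℕ → ℝ) → ℂ}, MemLp f 2 (digitLaw N B) →
          Integrable (fun x => f x * ch (l * ∑' i, x i)) (digitLaw N B) := fun hf =>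
        (hf.integrable one_le_two).mul_bdd hchm (.of_forall fun x => (norm_ch _).le)
      refine (norm_sq_le_two_mul _
        (∫ x, g (∑' i, x i) * ch (l * ∑' i, x i) ∂digitLaw N B)).trans_eq ?_
      rw [← integral_sub (hi (hgnL k)) (hi hgXL)]
      simp only [sub_mul]
    have hbes := h.bessel_digitLaw hΛ hC (subset_refl (Λ k)) ((hgnL k).sub hgXL)
    have hlow := (hΛ.level k).lower fun a => g (a / M)
    rw [← hAdef, ← hM] at hlow
    calc δ ^ 2 * c * ∫ x, ‖g (headSum (n k) x)‖ ^ 2 ∂digitLaw N B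
        = δ ^ 2 * ((A.card : ℝ)⁻¹ ^ 2 * (c * (A.card * ∑ a ∈ A, ‖g (a / M)‖ ^ 2))) := by
          rw [h.integral_norm_sq_headSum (n k) hg ⟨K, hK⟩, ← hAdef, ← hM]
          field_simp
      _ ≤ δ ^ 2 * ((A.card : ℝ)⁻¹ ^ 2 *
            ∑ l ∈ Λ k, ‖∑ a ∈ A, g (a / M) * ch (a * l / M)‖ ^ 2) := by gcongr
      _ = ∑ l ∈ Λ k, δ ^ 2 * ‖(A.card : ℂ)⁻¹ * ∑ a ∈ A, g (a / M) * ch (a * l / M)‖ ^ 2 := by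
          rw [Finset.mul_sum, Finset.mul_sum]
          refine Finset.sum_congr rfl fun l _ => ?_
          rw [norm_mul, mul_pow, norm_inv, Complex.norm_natCast]
      _ ≤ ∑ l ∈ Λ k, (2 * ‖∫ x, g (∑' i, x i) * ch (l * ∑' i, x i) ∂digitLaw N B‖ ^ 2 +
            2 * ‖∫ x, (g (headSum (n k) x) - g (∑' i, x i)) * ch (l * ∑' i, x i)
              ∂digitLaw N B‖ ^ 2) :=
          Finset.sum_le_sum fun l hl => (hcoef l hl).trans (hsplit l)
      _ ≤ _ := by
          rw [Finset.sum_add_distrib, ← Finset.mul_sum, ← Finset.mul_sum]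
          exact add_le_add (mul_le_mul_of_nonneg_left (hS k) two_pos.le)
            (mul_le_mul_of_nonneg_left hbes two_pos.le)
  refine le_of_tendsto_of_tendsto' (hlim1.const_mul _) ?_ hstep
  simpa using ((hlim2.const_mul C).const_mul 2).const_add (2 * S)

omit hΛ in
lemma isProbabilityMeasure_cantorMoran : IsProbabilityMeasure (cantorMoran N B) := by
  have : IsProbabilityMeasure (Measure.infinitePi (factor N B)) := h.isProbabilityMeasure_digitLaw
  exact Measure.isProbabilityMeasure_map h.aemeasurable_tsum

omit hΛ in
lemma integral_mul_ch_cantorMoran {f : ℝ → ℂ}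
    (hf : AEStronglyMeasurable f (cantorMoran N B)) (ξ : ℝ) :
    ∫ t, f t * ch (ξ * t) ∂cantorMoran N B =
      ∫ x, f (∑' i, x i) * ch (ξ * ∑' i, x i) ∂digitLaw N B := by
  refine integral_map h.aemeasurable_tsum (hf.mul ?_)
  exact (continuous_ch.comp (continuous_const.mul continuous_id)).aestronglyMeasurable

omit hΛ in
lemma integral_norm_sq_cantorMoran {f : ℝ → ℂ} (hf : AEStronglyMeasurable f (cantorMoran N B)) :
    ∫ t, ‖f t‖ ^ 2 ∂cantorMoran N B = ∫ x, ‖f (∑' i, x i)‖ ^ 2 ∂digitLaw N B :=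
  integral_map h.aemeasurable_tsum (hf.norm.pow 2)

/-- The Bessel inequality for the Cantor-Moran measure. -/
lemma bessel (hC : 0 ≤ C) {k : ℕ} {F : Finset ℤ} (hF : F ⊆ Λ k) {f : ℝ → ℂ}
    (hf : MemLp f 2 (cantorMoran N B)) :
    ∑ l ∈ F, ‖∫ t, f t * ch (l * t) ∂cantorMoran N B‖ ^ 2 ≤
      C * ∫ t, ‖f t‖ ^ 2 ∂cantorMoran N B := by
  have hfX : MemLp (fun x : ℕ → ℝ => f (∑' i, x i)) 2 (digitLaw N B) :=
    (memLp_map_measure_iff hf.1 h.aemeasurable_tsum).1 hf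
  simp only [h.integral_mul_ch_cantorMoran hf.1, h.integral_norm_sq_cantorMoran hf.1]
  exact h.bessel_digitLaw hΛ hC hF hfX

/-- The lower frame bound for the Cantor-Moran measure. -/
lemma lower (hc : 0 ≤ c) (hC : 0 ≤ C) (hδ : 0 ≤ δ) {f : ℝ → ℂ}
    (hf : MemLp f 2 (cantorMoran N B)) {S : ℝ}
    (hS : ∀ k, ∑ l ∈ Λ k, ‖∫ t, f t * ch (l * t) ∂cantorMoran N B‖ ^ 2 ≤ S) :
    δ ^ 2 * c * ∫ t, ‖f t‖ ^ 2 ∂cantorMoran N B ≤ 8 * S := by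
  have hprob := h.isProbabilityMeasure_cantorMoran
  set D := δ ^ 2 * c with hD
  have hD0 : 0 ≤ D := by positivity
  -- Approximate `f` in `L²` by a bounded continuous `g`. Three uses of `‖u‖² ≤ 2‖v‖² + 2‖u - v‖²`
  -- make up the `8`: passing from `f` to `g` in the coefficients, the bound for `g`, and returning
  -- to `f` in the norm.
  have key : ∀ η : ℝ, 0 < η → D * ∫ t, ‖f t‖ ^ 2 ∂cantorMoran N B ≤ 8 * S + (8 * C + 2 * D) * η := by
    intro η hη
    obtain ⟨g, hg, hgL⟩ := MemLp.exists_boundedContinuous_integral_rpow_sub_le (p := 2)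
      (μ := cantorMoran N B) two_pos (by simpa using hf) hη
    have hgL : MemLp g 2 (cantorMoran N B) := by simpa using hgL
    have hg' : ∫ t, ‖f t - g t‖ ^ 2 ∂cantorMoran N B ≤ η := by simpa using hg
    have hch : Continuous ch := continuous_ch
    have hi : ∀ {u : ℝ → ℂ}, MemLp u 2 (cantorMoran N B) → ∀ l : ℤ,
        Integrable (fun t => u t * ch (l * t)) (cantorMoran N B) := fun hu l =>
      (hu.integrable one_le_two).mul_bdd
        (hch.comp (continuous_const.mul continuous_id)).aestronglyMeasurable
        (.of_forall fun x => (norm_ch _).le)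
    have hSg : ∀ k, ∑ l ∈ Λ k, ‖∫ t, g t * ch (l * t) ∂cantorMoran N B‖ ^ 2 ≤
        2 * S + 2 * (C * η) := by
      intro k
      calc ∑ l ∈ Λ k, ‖∫ t, g t * ch (l * t) ∂cantorMoran N B‖ ^ 2
          ≤ ∑ l ∈ Λ k, (2 * ‖∫ t, f t * ch (l * t) ∂cantorMoran N B‖ ^ 2 +
              2 * ‖∫ t, (f t - g t) * ch (l * t) ∂cantorMoran N B‖ ^ 2) := by
            refine Finset.sum_le_sum fun l _ => (norm_sq_le_two_mul _
              (∫ t, f t * ch (l * t) ∂cantorMoran N B)).trans_eq ?_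
            rw [norm_sub_rev, ← integral_sub (hi hf l) (hi hgL l)]
            simp only [sub_mul]
        _ ≤ _ := by
            rw [Finset.sum_add_distrib, ← Finset.mul_sum, ← Finset.mul_sum]
            refine add_le_add (mul_le_mul_of_nonneg_left (hS k) two_pos.le)
              (mul_le_mul_of_nonneg_left ?_ two_pos.le)
            exact (h.bessel hΛ hC (subset_refl (Λ k)) (hf.sub hgL)).trans
              (mul_le_mul_of_nonneg_left hg' hC)
    have hlow : D * ∫ t, ‖g t‖ ^ 2 ∂cantorMoran N B ≤ 2 * (2 * S + 2 * (C * η)) := by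
      rw [h.integral_norm_sq_cantorMoran hgL.1]
      refine h.lower_of_continuous hΛ hC hδ g.continuous ⟨‖g‖, g.norm_coe_le_norm⟩ fun k => ?_
      simpa only [h.integral_mul_ch_cantorMoran hgL.1] using hSg k
    have hsq : ∀ {u : ℝ → ℂ}, MemLp u 2 (cantorMoran N B) →
        Integrable (fun t => ‖u t‖ ^ 2) (cantorMoran N B) := fun hu => by
      simpa using hu.integrable_norm_pow two_ne_zero
    have hsqg := (hsq hgL).const_mul 2
    have hsqfg : Integrable (fun t => 2 * ‖f t - g t‖ ^ 2) (cantorMoran N B) :=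
      (hsq (hf.sub hgL)).const_mul 2
    have hfg : ∫ t, ‖f t‖ ^ 2 ∂cantorMoran N B ≤
        2 * ∫ t, ‖g t‖ ^ 2 ∂cantorMoran N B + 2 * η := by
      calc _ ≤ ∫ t, (2 * ‖g t‖ ^ 2 + 2 * ‖f t - g t‖ ^ 2) ∂cantorMoran N B :=
            integral_mono (hsq hf) (hsqg.add hsqfg)
              fun t => norm_sq_le_two_mul _ _
        _ = 2 * ∫ t, ‖g t‖ ^ 2 ∂cantorMoran N B + 2 * ∫ t, ‖f t - g t‖ ^ 2 ∂cantorMoran N B := by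
            rw [integral_add hsqg hsqfg,
              integral_const_mul, integral_const_mul]
        _ ≤ _ := by linarith
    have := mul_le_mul_of_nonneg_left hfg hD0
    linarith
  have hl : Tendsto (fun η : ℝ => 8 * S + (8 * C + 2 * D) * η) (𝓝[>] 0) (𝓝 (8 * S)) := by
    have : Continuous fun η : ℝ => 8 * S + (8 * C + 2 * D) * η := by fun_prop
    simpa using (this.tendsto 0).mono_left nhdsWithin_le_nhds
  exact ge_of_tendsto hl (eventually_mem_nhdsWithin.mono fun η hη => key η hη)

end IsAdmissible

/-! ### From frame bounds to frame spectra and spectra -/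

/-- The frame inequalities for a set of integer frequencies, with explicit upper bound `C`. -/
structure HasFrameBounds (μ : Measure ℝ) (Λ : Set ℝ) (a C : ℝ) : Prop where
  subset : Λ ⊆ Set.range ((↑) : ℤ → ℝ)
  isProbabilityMeasure : IsProbabilityMeasure μ
  pos : 0 < a
  bessel : ∀ f : ℝ → ℂ, MemLp f 2 μ → ∀ u : Finset Λ,
    ∑ l ∈ u, ‖∫ x, f x * ch (l * x) ∂μ‖ ^ 2 ≤ C * ∫ x, ‖f x‖ ^ 2 ∂μ
  lower : ∀ f : ℝ → ℂ, MemLp f 2 μ →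
    a * ∫ x, ‖f x‖ ^ 2 ∂μ ≤ ∑' l : Λ, ‖∫ x, f x * ch (l * x) ∂μ‖ ^ 2

lemma exp_eq_ch (l x : ℝ) : Complex.exp (-2 * Real.pi * Complex.I * l * x) = ch (l * x) := by
  rw [ch]
  congr 1
  push_cast
  ring

lemma exp_eq_conj_ch (l x : ℝ) :
    Complex.exp (2 * Real.pi * Complex.I * l * x) = starRingEnd ℂ (ch (l * x)) := by
  rw [← ch_neg, ch]
  congr 1
  push_cast
  ring

lemma HasFrameBounds.summable {μ : Measure ℝ} {Λ : Set ℝ} {a C : ℝ} (h : HasFrameBounds μ Λ a C)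
    {f : ℝ → ℂ} (hf : MemLp f 2 μ) :
    Summable fun l : Λ => ‖∫ x, f x * ch (l * x) ∂μ‖ ^ 2 :=
  summable_of_sum_le (fun _ => by positivity) (h.bessel f hf)

lemma HasFrameBounds.countable {μ : Measure ℝ} {Λ : Set ℝ} {a C : ℝ}
    (h : HasFrameBounds μ Λ a C) : Λ.Countable :=
  (Set.countable_range _).mono h.subset

lemma HasFrameBounds.isFrameSpectrum {μ : Measure ℝ} {Λ : Set ℝ} {a C : ℝ}
    (h : HasFrameBounds μ Λ a C) : IsFrameSpectrum μ Λ := by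
  refine ⟨h.isProbabilityMeasure, h.countable, a, max a C, h.pos, le_max_left _ _, fun f hf => ?_⟩
  simp only [exp_eq_ch]
  refine ⟨h.summable hf, h.lower f hf, ?_⟩
  refine (Real.tsum_le_of_sum_le (fun _ => by positivity) (h.bessel f hf)).trans ?_
  exact mul_le_mul_of_nonneg_right (le_max_right _ _) (integral_nonneg fun x => by positivity)

/-- A tight upper bound makes the exponentials an orthonormal basis. -/
lemma HasFrameBounds.isSpectrum {μ : Measure ℝ} {Λ : Set ℝ} {a : ℝ}
    (h : HasFrameBounds μ Λ a 1) : IsSpectrum μ Λ := by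
  classical
  have hprob := h.isProbabilityMeasure
  have hc := continuous_ch
  have hmem : ∀ l : Λ, MemLp (fun x : ℝ => starRingEnd ℂ (ch (l * x))) 2 μ := fun l =>
    MemLp.of_bound (C := 1) (Continuous.aestronglyMeasurable (by fun_prop))
      (.of_forall fun x => by rw [RCLike.norm_conj, norm_ch])
  set v : Λ → Lp ℂ 2 μ := fun l => (hmem l).toLp _ with hv
  have hcoe : ∀ l, (v l : ℝ → ℂ) =ᵐ[μ] fun x => starRingEnd ℂ (ch (l * x)) := fun l =>
    (hmem l).coeFn_toLp
  have hinner : ∀ (l : Λ) (f : Lp ℂ 2 μ), inner ℂ (v l) f = ∫ x, f x * ch (l * x) ∂μ := by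
    intro l f
    rw [L2.inner_def]
    refine integral_congr_ae ?_
    filter_upwards [hcoe l] with x hx
    rw [hx, RCLike.inner_apply, Complex.conj_conj]
  have hnormsq : ∀ f : Lp ℂ 2 μ, ∫ x, ‖f x‖ ^ 2 ∂μ = ‖f‖ ^ 2 := by
    intro f
    have h1 : ((∫ x, ‖f x‖ ^ 2 ∂μ : ℝ) : ℂ) = ((‖f‖ ^ 2 : ℝ) : ℂ) := by
      have e := inner_self_eq_norm_sq_to_K (𝕜 := ℂ) f
      rw [L2.inner_def] at e
      rw [← integral_complex_ofReal, Complex.ofReal_pow]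
      refine Eq.trans (integral_congr_ae (.of_forall fun x => ?_)) e
      dsimp only
      rw [RCLike.inner_apply, Complex.ofReal_pow]
      exact (Complex.mul_conj' _).symm
    exact Complex.ofReal_injective h1
  have hnorm : ∀ l, ‖v l‖ = 1 := by
    intro l
    have h1 : ‖v l‖ ^ 2 = 1 := by
      rw [← hnormsq, integral_congr_ae (g := fun _ => (1 : ℝ))]
      · simp
      · filter_upwards [hcoe l] with x hx
        rw [hx, RCLike.norm_conj, norm_ch, one_pow]
    exact (pow_eq_one_iff_of_nonneg (norm_nonneg _) two_ne_zero).1 h1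
  have horth : Orthonormal ℂ v := by
    refine ⟨hnorm, fun l l' hll => ?_⟩
    -- Bessel with constant `1` for the unit vector `v l'`: its own coefficient already exhausts the
    -- bound, so the coefficient at `l` vanishes.
    have h1 := h.bessel (v l') (Lp.memLp _) {l, l'}
    rw [Finset.sum_pair hll, ← hinner, ← hinner, hnormsq, inner_self_eq_norm_sq_to_K, hnorm] at h1
    have h2 : ‖inner ℂ (v l) (v l')‖ ^ 2 ≤ 0 := by
      norm_num at h1
      simpa using h1
    exact norm_eq_zero.1 (pow_eq_zero_iff two_ne_zero |>.1 (le_antisymm h2 (by positivity)))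
  -- Completeness needs only the positivity of the lower constant, not its value.
  have hbot : (Submodule.span ℂ (Set.range v))ᗮ = ⊥ := by
    rw [Submodule.eq_bot_iff]
    intro f hf
    have h1 := h.lower f (Lp.memLp f)
    have h2 : ∀ l : Λ, ∫ x, f x * ch (l * x) ∂μ = 0 := by
      intro l
      rw [← hinner]
      exact (Submodule.mem_orthogonal _ _).1 hf _ (Submodule.subset_span ⟨l, rfl⟩)
    simp only [h2, hnormsq, norm_zero, ne_eq, OfNat.ofNat_ne_zero, not_false_eq_true, zero_pow,
      tsum_zero] at h1
    have h3 : ‖f‖ ^ 2 ≤ 0 := by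
      by_contra! h4
      exact absurd h1 (not_le.2 (mul_pos h.pos h4))
    exact norm_eq_zero.1 (pow_eq_zero_iff two_ne_zero |>.1 (le_antisymm h3 (by positivity)))
  refine ⟨hprob, h.countable, HilbertBasis.mkOfOrthogonalEqBot horth hbot, fun l => ?_⟩
  rw [HilbertBasis.coe_mkOfOrthogonalEqBot]
  simp only [exp_eq_conj_ch]
  exact hcoe l

/-- A frame tower with equi-positive tails yields integer frequencies with frame bounds. -/
lemma IsAdmissible.exists_hasFrameBounds {N : ℕ → ℕ} {B L : ℕ → Finset ℤ} {c C : ℕ → ℝ}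
    {c₀ C₀ : ℝ} (h : IsAdmissible N B) (hT : IsFrameTower N B L c C c₀ C₀) {s : ℕ → ℕ}
    (hs : StrictMono s) (hpos : EquiPositive (Set.range fun k => nu N B (s k))) :
    ∃ (Λ : Set ℝ) (a : ℝ), HasFrameBounds (cantorMoran N B) Λ a C₀ := by
  classical
  obtain ⟨δ, hδ, n, Λ, hn, hmono, hlev, hle⟩ := h.exists_levels hT hs hpos
  have hΛ : IsLevelSequence N B c₀ C₀ δ n Λ :=
    ⟨hn, hmono, fun k => (hlev k).mono (hT.le_prod _) (hT.prod_le _), hle⟩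
  have hC₀ : 0 ≤ C₀ := zero_le_one.trans (by simpa using hT.prod_le 0)
  have hc₀ := hT.pos
  set S : Set ℝ := {x | ∃ k, ∃ l ∈ Λ k, (l : ℝ) = x} with hS
  have hbes : ∀ f : ℝ → ℂ, MemLp f 2 (cantorMoran N B) → ∀ u : Finset S,
      ∑ l ∈ u, ‖∫ x, f x * ch (l * x) ∂cantorMoran N B‖ ^ 2 ≤
        C₀ * ∫ x, ‖f x‖ ^ 2 ∂cantorMoran N B := by
    intro f hf u
    choose k l hl hlx using fun x : S => x.2
    -- As the sets `Λ k` increase, finitely many frequencies of the union lie in a single `Λ K`.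
    obtain ⟨K, hK⟩ : ∃ K, ∀ x ∈ u, k x ≤ K := ⟨u.sup k, fun x hx => Finset.le_sup hx⟩
    have hinj : Function.Injective l := fun x y e => Subtype.ext (by rw [← hlx x, ← hlx y, e])
    have hsub : u.image l ⊆ Λ K := fun y hy => by
      obtain ⟨x, hx, rfl⟩ := Finset.mem_image.1 hy
      exact hmono (hK x hx) (hl x)
    have := h.bessel hΛ hC₀ hsub hf
    rw [Finset.sum_image hinj.injOn] at this
    simpa only [hlx] using this
  refine ⟨S, δ ^ 2 * c₀ / 8, ⟨?_, h.isProbabilityMeasure_cantorMoran, by positivity, hbes,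
    fun f hf => ?_⟩⟩
  · rintro _ ⟨k, l, -, rfl⟩
    exact ⟨l, rfl⟩
  · have hsum : Summable fun l : S => ‖∫ x, f x * ch (l * x) ∂cantorMoran N B‖ ^ 2 :=
      summable_of_sum_le (fun _ => by positivity) (hbes f hf)
    have := h.lower hΛ hc₀.le hC₀ hδ.le hf fun k => by
      have hle := hsum.sum_le_tsum ((Λ k).attach.image fun l => (⟨l.1, k, l.1, l.2, rfl⟩ : S))
        fun _ _ => by positivity
      rw [Finset.sum_image] at hle
      · exact (Finset.sum_attach (Λ k) fun l : ℤ =>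
          ‖∫ x, f x * ch (l * x) ∂cantorMoran N B‖ ^ 2).symm.trans_le hle
      · intro l _ l' _ e
        have e' : ((l : ℤ) : ℝ) = (l' : ℤ) := congrArg Subtype.val e
        exact Subtype.ext (by exact_mod_cast e')
    linarith

end CantorMoran

end

theorem theorem3p2 (N : ℕ → ℕ) (B L : ℕ → Finset ℤ)
    (hB : ∀ n, B n ⊆ Finset.Ico (0 : ℤ) (N n)) (hB0 : ∀ n, (0 : ℤ) ∈ B n)
    (hL0 : ∀ n, (0 : ℤ) ∈ L n)
    (hL : ∀ n, ∀ l ∈ L n, ∀ l' ∈ L n, l ≡ l' [ZMOD (N n : ℤ)] → l = l')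
    (hpos : ∃ s : ℕ → ℕ, StrictMono s ∧
      CantorMoran.EquiPositive (Set.range fun k => CantorMoran.nu N B (s k))) :
    (CantorMoran.IsFrameTripleTower N B L →
      ∃ Λ : Set ℝ, Λ ⊆ Set.range ((↑) : ℤ → ℝ) ∧
        CantorMoran.IsFrameSpectrum (CantorMoran.cantorMoran N B) Λ) ∧
    (CantorMoran.IsHadamardTripleTower N B L →
      ∃ Λ : Set ℝ, Λ ⊆ Set.range ((↑) : ℤ → ℝ) ∧
        CantorMoran.IsSpectrum (CantorMoran.cantorMoran N B) Λ) := by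
  obtain ⟨s, hs, hpos⟩ := hpos
  constructor
  · rintro ⟨ε, hε, hsum, hF⟩
    obtain ⟨c₀, C₀, hc₀, hle, hge⟩ := CantorMoran.exists_prod_bounds hε hsum
    have h : CantorMoran.IsAdmissible N B := ⟨fun n => (hF n).1, hB, hB0⟩
    obtain ⟨Λ, a, hΛ⟩ := h.exists_hasFrameBounds
      ⟨fun n => (hF n).isFrameLevel ⟨0, hB0 n⟩ (hL n), hL0, fun n => by positivity,
        fun n => by positivity, hc₀, hle, hge⟩ hs hpos
    exact ⟨Λ, hΛ.subset, hΛ.isFrameSpectrum⟩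
  · intro hH
    have h : CantorMoran.IsAdmissible N B := ⟨fun n => (hH n).1, hB, hB0⟩
    -- All constants of a Hadamard tower equal `1`, so the Bessel constant is exactly `1`, as
    -- `isSpectrum` requires.
    obtain ⟨Λ, a, hΛ⟩ := h.exists_hasFrameBounds (C₀ := 1)
      ⟨fun n => (hH n).isFrameTriple.isFrameLevel ⟨0, hB0 n⟩ (hL n), hL0, fun n => by positivity,
        fun n => by positivity, one_pos, fun n => by simp, fun n => by simp⟩ hs hpos
    exact ⟨Λ, hΛ.subset, hΛ.isSpectrum⟩
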